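/- **Setting.** A seller offers two goods to a buyer whose type $\mathbf x=(x_1,x_2)$ is drawn from a distribution on $[0,1]^2$ with probability density $f$. The function $f$ is continuously differentiable on $(0,1)^2$ and extends continuously to the points of the edges $x_1=1$ and $x_2=1$ with positive coordinates; it is bounded on these edges and positive at almost all of their points. The function $\phi(\mathbf x)=\mathbf x\cdot\nabla f(\mathbf x)+3f(\mathbf x)$ is bounded on $(0,1)^2$. The environment is strictly regular and symmetric (SRS): $\phi>0$ almost everywhere and $f(x_1,x_2)=f(x_2,x_1)$. For $x_1\in(0,1)$ put $$\zeta(x_1)=\sup\Big\{z\in[0,1]:\int_z^1\phi(x_1,x_2)\,dx_2-f(x_1,1)\ge 0\Big\},\qquad \sup\emptyset=0 .$$ A mechanism is a price schedule $p:[0,1]^2\to\mathbb R$ with $p(0,0)=0$ and finite indirect utility $u(\mathbf x)=\sup_{\mathbf q\in[0,1]^2}\{\mathbf x\cdot\mathbf q-p(\mathbf q)\}$. It is symmetric if $u(x_1,x_2)=u(x_2,x_1)$, and optimal if it maximizes the revenue $\int_{[0,1]^2}[\mathbf x\cdot\nabla u(\mathbf x)-u(\mathbf x)]f(\mathbf x)\,d\mathbf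 x$ among all such price schedules. Write $\overline u(x)=u(x,1)$. The demand set of $\mathbf q\in[0,1]^2$ is the set of all $\mathbf x\in[0,1]^2$ with $\mathbf x\cdot\mathbf q-u(\mathbf x)\ge\hat{\mathbf x}\cdot\mathbf q-u(\hat{\mathbf x})$ for all $\hat{\mathbf x}\in[0,1]^2$. A bundle $\mathbf q\ne(0,0)$ is active if for every $\delta>0$ the union of the demand sets of all bundles at Euclidean distance less than $\delta$ from $\mathbf q$ has positive probability. **Corollary.** Suppose that $\zeta$ is nondecreasing on $(0,1)$ and crosses the 45-degree line exactly once, that is, $\zeta(x)=x$ for exactly one $x\in(0,1)$. Then every symmetric optimal mechanism is deterministic, that is, every active bundle is one of $(1,0)$, $(0,1)$, $(1,1)$. Moreover, there exists $a^1\in[0,1)$ such that 1. $\overline u'(x)=0$ for $x\in[0,a^1)$, 2. $\overline u'(x)=1$ for $x\in[a^1,1]$, where the derivative is the right derivative at $x=0$ and at $x=a^1$, and the left derivative at $x=1$. -/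

import Mathlib

open MeasureTheory Set

noncomputable section

namespace TwoGoods

/-- The square `[0,1]²`: both the type space and the set of bundles. -/
def unitSquare : Set (ℝ × ℝ) := Icc 0 1 ×ˢ Icc 0 1

/-- The interior `(0,1)²` of the type space. -/
def openSquare : Set (ℝ × ℝ) := Ioo 0 1 ×ˢ Ioo 0 1

/-- The Euclidean inner product `x · q` on the plane. -/
def dot (x q : ℝ × ℝ) : ℝ := x.1 * q.1 + x.2 * q.2

/-! ### The distribution of types -/

/-- The marginal revenue density `φ(x) = x · ∇f(x) + 3 f(x)`; it is used only on the open
square, where the density `f` is differentiable. -/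
def phi (f : ℝ × ℝ → ℝ) (x : ℝ × ℝ) : ℝ := fderiv ℝ f x x + 3 * f x

/-- Standing assumptions on the probability density `f` of the type distribution on `[0,1]²`.
The values on the edges `x₁ = 1` and `x₂ = 1` are those of the continuous extension of `f`; its
values where `x₁ = 0` or `x₂ = 0` play no role. -/
structure IsTypeDensity (f : ℝ × ℝ → ℝ) : Prop where
  nonneg : ∀ x ∈ unitSquare, 0 ≤ f x
  integrable : IntegrableOn f unitSquare volume
  integral_eq_one : ∫ x in unitSquare, f x = 1
  contDiffOn : ContDiffOn ℝ 1 f openSquare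
  continuousOn : ContinuousOn f (Ioc 0 1 ×ˢ Ioc 0 1)
  boundary_bounded : ∃ M : ℝ, ∀ t ∈ Ioc (0 : ℝ) 1, f (t, 1) ≤ M ∧ f (1, t) ≤ M
  phi_bounded : ∃ M : ℝ, ∀ x ∈ openSquare, |phi f x| ≤ M
  boundary_pos : ∀ᵐ t ∂(volume.restrict (Icc (0 : ℝ) 1)), 0 < f (t, 1) ∧ 0 < f (1, t)

/-- A strictly regular and symmetric environment. -/
structure IsSRS (f : ℝ × ℝ → ℝ) : Prop extends IsTypeDensity f where
  strictly_regular : ∀ᵐ x ∂(volume.restrict unitSquare), 0 < phi f x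
  symmetric : ∀ x ∈ unitSquare, f x.swap = f x

/-- The threshold function
`ζ(x₁) = sup {z ∈ [0,1] : ∫_z^1 φ(x₁,x₂) dx₂ - f(x₁,1) ≥ 0}`, with `sup ∅ = 0`. -/
def zeta (f : ℝ × ℝ → ℝ) (x₁ : ℝ) : ℝ :=
  sSup {z : ℝ | z ∈ Icc (0 : ℝ) 1 ∧ 0 ≤ (∫ x₂ in z..1, phi f (x₁, x₂)) - f (x₁, 1)}

/-! ### Mechanisms -/

/-- A price schedule on `[0,1]²` with price zero for the zero bundle. It is bounded below, which
says exactly that the induced indirect utility is finite. Only its values on the square matter. -/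
structure IsPriceSchedule (p : ℝ × ℝ → ℝ) : Prop where
  zero_bundle : p (0, 0) = 0
  bddBelow : BddBelow (p '' unitSquare)

/-- The indirect utility `u(x) = sup_{q ∈ [0,1]²} (x · q - p(q))`. -/
def indirectUtility (p : ℝ × ℝ → ℝ) (x : ℝ × ℝ) : ℝ :=
  sSup ((fun q => dot x q - p q) '' unitSquare)

/-- The indirect utility of the boundary types, `ū(x) = u(x,1)`. -/
def boundaryUtility (p : ℝ × ℝ → ℝ) (x : ℝ) : ℝ := indirectUtility p (x, 1)

/-- The seller's total revenue `∫ (x · ∇u(x) - u(x)) f(x) dx` over the type space. -/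
def totalRevenue (f p : ℝ × ℝ → ℝ) : ℝ :=
  ∫ x in unitSquare, (fderiv ℝ (indirectUtility p) x x - indirectUtility p x) * f x

/-- A mechanism is optimal if it maximizes total revenue among all price schedules. -/
def IsOptimal (f p : ℝ × ℝ → ℝ) : Prop :=
  IsPriceSchedule p ∧ ∀ p', IsPriceSchedule p' → totalRevenue f p' ≤ totalRevenue f p

/-- A mechanism is symmetric if its indirect utility is symmetric on the type space. -/
def IsSymmetric (p : ℝ × ℝ → ℝ) : Prop :=
  ∀ x ∈ unitSquare, indirectUtility p x.swap = indirectUtility p x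

/-- The subdifferential of the indirect utility at the type `x`, within the set of bundles. -/
def subdifferential (p : ℝ × ℝ → ℝ) (x : ℝ × ℝ) : Set (ℝ × ℝ) :=
  {q | q ∈ unitSquare ∧
    ∀ y ∈ unitSquare, dot y q - indirectUtility p y ≤ dot x q - indirectUtility p x}

/-- The demand set of the bundle `q`. -/
def demandSet (p : ℝ × ℝ → ℝ) (q : ℝ × ℝ) : Set (ℝ × ℝ) :=
  {x | x ∈ unitSquare ∧ q ∈ subdifferential p x}

/-- The distribution of types with density `f`. -/
def typeMeasure (f : ℝ × ℝ → ℝ) : Measure (ℝ × ℝ) :=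
  (volume.restrict unitSquare).withDensity (fun x => ENNReal.ofReal (f x))

/-- The bundles at Euclidean distance less than `δ` from `q`. -/
def nearbyBundles (q : ℝ × ℝ) (δ : ℝ) : Set (ℝ × ℝ) :=
  {r | r ∈ unitSquare ∧ Real.sqrt ((r.1 - q.1) ^ 2 + (r.2 - q.2) ^ 2) < δ}

/-- A nonzero bundle is active if, for every `δ > 0`, the types demanding some bundle within
distance `δ` of it have positive mass. -/
def IsActive (f p : ℝ × ℝ → ℝ) (q : ℝ × ℝ) : Prop :=
  q ∈ unitSquare ∧ q ≠ (0, 0) ∧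
    ∀ δ : ℝ, 0 < δ → 0 < typeMeasure f (⋃ r ∈ nearbyBundles q δ, demandSet p r)

/-- A mechanism is deterministic if no active bundle has a fractional quantity. -/
def IsDeterministic (f p : ℝ × ℝ → ℝ) : Prop :=
  ∀ q, IsActive f p q → q = (1, 0) ∨ q = (0, 1) ∨ q = (1, 1)

end TwoGoods

end

noncomputable section

namespace TwoGoods

open Filter Topology

/-! By symmetry, revenue is twice its part from the triangle `x₁ < x₂`. The divergence theorem there
(`integral_upperTriangle_revenue`), proved ray by ray from the origin, turns that part into `∫ ū(t)
f(t,1) dt - ∫ u φ`. The diagonal is itself a ray, so it carries no boundary term.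

Since `φ > 0`, for given boundary values `ū` the seller wants `u` as small as possible inside.
Quantities lie in `[0,1]`, so `u(x) ≥ max (ū(x₁) + x₂ - 1) 0` (`lower_bound_indirectUtility`).
Revenue is therefore at most twice the integral of `sliceRevenue f t (ū t)`. The slice revenue is
concave in the boundary utility `s`, with slope minus the net margin at `max t (1 - s)`
(`sliceRevenue_le`). If `ζ(t) < t` it increases in `s`; if `ζ(t) > t` it peaks at the target `s = 1
- ζ(t)`.

Let `a` be the crossing. To its right `ζ(t) < t` (`zeta_lt_self_of_gt_crossing`), so raising `ū`
pays. To its left the target is nonincreasing while `ū` is nondecreasing, so there is a switching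
point `d` (`exists_switching_point`): on `(0,d)` raising `ū` to `ū(d)` pays, and on `(d,a)` lowering
it pays as long as it stays at least `ū(d)`. As `ū` has slopes in `[0,1]`, the function `max (ū d)
(t + ū a - a)` lies above `ū` on `(0,d)`, below it on `(d,a)` and above it on `(a,1)`, so it
improves every slice where it differs from `ū`.

This function is the boundary utility of a deterministic menu, and the menu attains the lower bound
on `u` in the triangle. An optimal `u` must hence coincide with the menu utility
(`indirectUtility_eq_menuUtility`, `exists_menuUtility`). Determinism and the two slopes of `ū` are
read off from the menu. -/

/-! ### Integration by parts along a ray -/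

/-- If `h` is integrable near zero then `r * h r` has no nonzero limit at zero. -/
theorem eq_zero_of_tendsto_mul_of_integrable {h : ℝ → ℝ} {l : ℝ}
    (hi : IntegrableOn h (Ioo 0 1)) (hl : Tendsto (fun r => r * h r) (𝓝[>] 0) (𝓝 l)) : l = 0 := by
  by_contra hne
  have hpos : 0 < |l| / 2 := by positivity
  have h1 : ∀ᶠ r in 𝓝[>] (0 : ℝ), |l| / 2 < |r * h r| :=
    hl.abs.eventually (lt_mem_nhds (by linarith))
  obtain ⟨δ, hδ, hsub⟩ := (mem_nhdsGT_iff_exists_Ioo_subset).1 h1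
  have hδ0 : (0 : ℝ) < min δ 1 := lt_min hδ one_pos
  -- A nonzero limit forces `|h r| > |l| / (2 r)` near zero, so `1 / r` would be integrable there.
  have : IntegrableOn (fun r : ℝ => r⁻¹) (Ioo 0 (min δ 1)) := by
    have h2 : IntegrableOn (fun r => (2 / |l|) * h r) (Ioo 0 (min δ 1)) :=
      (hi.mono_set (Ioo_subset_Ioo_right (min_le_right _ _))).const_mul _
    refine Integrable.mono h2 (by fun_prop) ?_
    refine (ae_restrict_iff' measurableSet_Ioo).2 (Eventually.of_forall fun r hr => ?_)
    have h3 : |l| / 2 < |r * h r| := hsub ⟨hr.1, hr.2.trans_le (min_le_left _ _)⟩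
    have hr0 : 0 < r := hr.1
    rw [abs_mul, abs_of_pos hr0] at h3
    have hl0 : 0 < |l| := by linarith
    rw [Real.norm_eq_abs, Real.norm_eq_abs, abs_mul, abs_of_pos (inv_pos.2 hr0),
      abs_of_pos (by positivity : 0 < 2 / |l|), inv_le_iff_one_le_mul₀ hr0]
    rw [div_mul_eq_mul_div, div_mul_eq_mul_div, le_div_iff₀ hl0]
    nlinarith
  have h4 : IntervalIntegrable (fun r : ℝ => r⁻¹) volume 0 (min δ 1) :=
    (intervalIntegrable_iff_integrableOn_Ioo_of_le hδ0.le).2 this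
  rw [intervalIntegrable_inv_iff] at h4
  rcases h4 with h4 | h4
  · exact hδ0.ne h4
  · exact h4 left_mem_uIcc

/-- Integration by parts along a ray: `U` is the utility and `g` the density on the ray, and
`ψ r = r * g' r + 3 * g r`. -/
theorem integral_ray {U g ψ : ℝ → ℝ} {C : NNReal} {M : ℝ} (hU : LipschitzWith C U)
    (hg : ContinuousOn g (Ioc 0 1))
    (hg' : ∀ r ∈ Ioo (0 : ℝ) 1, HasDerivAt g ((ψ r - 3 * g r) / r) r)
    (hψ : ContinuousOn ψ (Ioo 0 1)) (hM : ∀ r ∈ Ioo (0 : ℝ) 1, |ψ r| ≤ M)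
    (hgi : IntegrableOn (fun r => r * g r) (Ioo 0 1)) :
    ∫ r in Ioo (0 : ℝ) 1, r * ((r * deriv U r - U r) * g r + U r * ψ r) = U 1 * g 1 := by
  set F : ℝ → ℝ := fun r => r * ((r * deriv U r - U r) * g r + U r * ψ r) with hF
  have hUc : Continuous U := hU.continuous
  obtain ⟨B, hB⟩ : ∃ B, ∀ r ∈ Icc (0 : ℝ) 1, ‖U r‖ ≤ B :=
    isCompact_Icc.exists_bound_of_continuousOn hUc.continuousOn
  have hUi : IntegrableOn (fun r => U r * (r * g r)) (Ioo 0 1) := by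
    refine hgi.bdd_mul (c := B) hUc.aestronglyMeasurable ?_
    exact (ae_restrict_iff' measurableSet_Ioo).2
      (Eventually.of_forall fun r hr => hB r (Ioo_subset_Icc_self hr))
  have hψi : IntegrableOn ψ (Ioo 0 1) :=
    Integrable.of_bound (hψ.aestronglyMeasurable measurableSet_Ioo) M
      ((ae_restrict_iff' measurableSet_Ioo).2 (Eventually.of_forall fun r hr => hM r hr))
  have hFi : IntegrableOn F (Ioo 0 1) := by
    have h1 : IntegrableOn (fun r => (r * deriv U r) * (r * g r)) (Ioo 0 1) := by
      refine hgi.bdd_mul (c := C) ((measurable_id.mul (measurable_deriv U)).aestronglyMeasurable) ?_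
      refine (ae_restrict_iff' measurableSet_Ioo).2 (Eventually.of_forall fun r hr => ?_)
      have := norm_deriv_le_of_lipschitz (x₀ := r) hU
      rw [norm_mul, Real.norm_eq_abs, abs_of_pos hr.1]
      calc r * ‖deriv U r‖ ≤ 1 * C := by
            gcongr
            exact hr.2.le
        _ = C := one_mul _
    have h2 : IntegrableOn (fun r => (r * U r) * ψ r) (Ioo 0 1) := by
      refine hψi.bdd_mul (c := B) (by fun_prop) ?_
      refine (ae_restrict_iff' measurableSet_Ioo).2 (Eventually.of_forall fun r hr => ?_)
      have := hB r (Ioo_subset_Icc_self hr)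
      rw [norm_mul, Real.norm_eq_abs, abs_of_pos hr.1]
      calc r * ‖U r‖ ≤ 1 * B := by
            gcongr
            exact hr.2.le
        _ = B := one_mul _
    refine ((h1.sub hUi).add h2).congr (Eventually.of_forall fun r => ?_)
    simp only [hF, Pi.add_apply, Pi.sub_apply]
    ring
  have hFii : IntervalIntegrable F volume 0 1 :=
    (intervalIntegrable_iff_integrableOn_Ioo_of_le zero_le_one).2 hFi
  -- `F` is the derivative of `U r * (r ^ 2 * g r)`, because `(r ^ 2 * g)' = r * (ψ - g)`. The
  -- density may blow up at the origin, so the integration stops at `ε`.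
  have key : ∀ ε ∈ Ioo (0 : ℝ) 1, ∫ r in ε..1, F r = U 1 * g 1 - ε * (U ε * (ε * g ε)) := by
    intro ε hε
    have hGc : ContinuousOn (fun r => r ^ 2 * g r) (Icc ε 1) :=
      (continuousOn_id.pow 2).mul (hg.mono fun r hr => ⟨hε.1.trans_le hr.1, hr.2⟩)
    have hGd : ∀ r ∈ Ioo (0 : ℝ) 1, HasDerivAt (fun r => r ^ 2 * g r) (r * (ψ r - g r)) r := by
      intro r hr
      have hr0 : r ≠ 0 := hr.1.ne'
      convert! (hasDerivAt_pow 2 r).mul (hg' r hr) using 1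
      field_simp
      push_cast
      ring
    obtain ⟨B', hB'⟩ : ∃ B', ∀ r ∈ Icc ε 1, ‖g r‖ ≤ B' :=
      isCompact_Icc.exists_bound_of_continuousOn
        (hg.mono fun r hr => ⟨hε.1.trans_le hr.1, hr.2⟩)
    have hbd : ∀ r ∈ Ioo ε 1, ‖r * (ψ r - g r)‖ ≤ (M + B').toNNReal := by
      intro r hr
      have hr' : r ∈ Ioo (0 : ℝ) 1 := ⟨hε.1.trans hr.1, hr.2⟩
      have h1 := hM r hr'
      have h2 := hB' r (Ioo_subset_Icc_self hr)
      rw [norm_mul, Real.norm_eq_abs, abs_of_pos hr'.1]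
      calc r * ‖ψ r - g r‖ ≤ 1 * (M + B') := by
            gcongr
            · exact hr.2.le
            · exact (norm_sub_le _ _).trans (add_le_add h1 h2)
        _ ≤ _ := by rw [one_mul]; exact Real.le_coe_toNNReal _
    -- The derivative is known only in the open interval; continuity of `g` carries the Lipschitz
    -- bound to the endpoint `1`.
    have hGl : LipschitzOnWith (M + B').toNNReal (fun r => r ^ 2 * g r) (Icc ε 1) := by
      have h1 : LipschitzOnWith (M + B').toNNReal (fun r => r ^ 2 * g r) (Ioo ε 1) := by
        refine (convex_Ioo ε 1).lipschitzOnWith_of_nnnorm_hasDerivWithin_le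
          (f' := fun r => r * (ψ r - g r))
          (fun r hr => (hGd r ⟨hε.1.trans hr.1, hr.2⟩).hasDerivWithinAt) ?_
        intro r hr
        exact_mod_cast hbd r hr
      have h2 := h1.closure (by rwa [closure_Ioo hε.2.ne])
      rwa [closure_Ioo hε.2.ne] at h2
    have hGa : AbsolutelyContinuousOnInterval (fun r => r ^ 2 * g r) ε 1 :=
      LipschitzOnWith.absolutelyContinuousOnInterval (by rwa [uIcc_of_le hε.2.le])
    have hUa : AbsolutelyContinuousOnInterval U ε 1 :=
      LipschitzOnWith.absolutelyContinuousOnInterval hU.lipschitzOnWith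
    have h := hUa.integral_deriv_mul_eq_sub hGa
    have h' : ∫ r in ε..1, F r =
        ∫ r in ε..1, deriv U r * (r ^ 2 * g r) + U r * deriv (fun r => r ^ 2 * g r) r := by
      rw [intervalIntegral.integral_of_le hε.2.le, intervalIntegral.integral_of_le hε.2.le,
        integral_Ioc_eq_integral_Ioo, integral_Ioc_eq_integral_Ioo]
      refine setIntegral_congr_fun measurableSet_Ioo fun r hr => ?_
      simp only [(hGd r ⟨hε.1.trans hr.1, hr.2⟩).deriv, hF]
      ring
    rw [h', h]
    ring
  have hlim : Tendsto (fun ε => ∫ r in ε..1, F r) (𝓝[>] 0) (𝓝 (∫ r in (0 : ℝ)..1, F r)) := by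
    have hc := intervalIntegral.continuousOn_primitive_interval_left
      (μ := volume) (f := F) (a := 0) (b := 1)
      (by rw [uIcc_of_le zero_le_one, integrableOn_Icc_iff_integrableOn_Ioo]; exact hFi)
    rw [uIcc_of_le zero_le_one] at hc
    have h0 := hc 0 (left_mem_Icc.2 zero_le_one)
    refine h0.tendsto.mono_left ?_
    rw [← nhdsWithin_Ioo_eq_nhdsGT one_pos]
    exact nhdsWithin_mono _ Ioo_subset_Icc_self
  -- The boundary term at `ε` converges because `F` is integrable. It has the form `ε * h ε` with `h
  -- = U r * (r * g r)` integrable, so its limit can only be zero.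
  have hlim2 : Tendsto (fun ε => ε * (U ε * (ε * g ε))) (𝓝[>] 0)
      (𝓝 (U 1 * g 1 - ∫ r in (0 : ℝ)..1, F r)) := by
    refine (hlim.const_sub (U 1 * g 1)).congr' ?_
    filter_upwards [Ioo_mem_nhdsGT (one_pos : (0 : ℝ) < 1)] with ε hε
    rw [key ε hε]
    ring
  have h0 := eq_zero_of_tendsto_mul_of_integrable hUi hlim2
  rw [intervalIntegral.integral_of_le zero_le_one, integral_Ioc_eq_integral_Ioo] at h0
  linarith

/-! ### The upper triangle and its parametrization by rays -/

/-- The open triangle above the diagonal of the unit square. -/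
def upperTriangle : Set (ℝ × ℝ) := {x | 0 < x.1 ∧ x.1 < x.2 ∧ x.2 < 1}

theorem isOpen_upperTriangle : IsOpen upperTriangle :=
  (isOpen_lt continuous_const continuous_fst).inter
    ((isOpen_lt continuous_fst continuous_snd).inter (isOpen_lt continuous_snd continuous_const))

theorem measurableSet_upperTriangle : MeasurableSet upperTriangle :=
  isOpen_upperTriangle.measurableSet

theorem isOpen_openSquare : IsOpen openSquare := isOpen_Ioo.prod isOpen_Ioo

theorem measurableSet_openSquare : MeasurableSet openSquare := isOpen_openSquare.measurableSet

theorem openSquare_subset_unitSquare : openSquare ⊆ unitSquare :=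
  prod_mono Ioo_subset_Icc_self Ioo_subset_Icc_self

theorem upperTriangle_subset_openSquare : upperTriangle ⊆ openSquare :=
  fun _ hx => ⟨⟨hx.1, hx.2.1.trans hx.2.2⟩, ⟨hx.1.trans hx.2.1, hx.2.2⟩⟩

/-- The parametrization `(t, r) ↦ r • (t, 1)` of the upper triangle by rays. -/
def rayMap (z : ℝ × ℝ) : ℝ × ℝ := (z.2 * z.1, z.2)

theorem rayMap_image : rayMap '' openSquare = upperTriangle := by
  ext ⟨a, b⟩
  constructor
  · rintro ⟨⟨t, r⟩, ⟨⟨ht0, ht1⟩, hr0, hr1⟩, h⟩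
    simp only [rayMap, Prod.mk.injEq] at h ht0 ht1 hr0 hr1
    obtain ⟨rfl, rfl⟩ := h
    exact ⟨mul_pos hr0 ht0, by simpa using mul_lt_mul_of_pos_left ht1 hr0, hr1⟩
  · rintro ⟨h0, h1, h2⟩
    simp only at h0 h1 h2
    have hb : 0 < b := h0.trans h1
    refine ⟨(a / b, b), ⟨⟨div_pos h0 hb, (div_lt_one hb).2 h1⟩, hb, h2⟩, ?_⟩
    simp only [rayMap, Prod.mk.injEq, and_true]
    field_simp

theorem injOn_rayMap : InjOn rayMap openSquare := by
  rintro ⟨t, r⟩ ⟨_, hr, _⟩ ⟨t', r'⟩ _ h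
  simp only [rayMap, Prod.mk.injEq] at h
  obtain ⟨h1, rfl⟩ := h
  have : t = t' := mul_left_cancel₀ (ne_of_gt hr) h1
  rw [this]

/-- The derivative of `rayMap`. -/
def rayMapDeriv (z : ℝ × ℝ) : ℝ × ℝ →L[ℝ] ℝ × ℝ :=
  (Matrix.toLin (.finTwoProd ℝ) (.finTwoProd ℝ)
    !![z.2, z.1; 0, 1]).toContinuousLinearMap

theorem hasFDerivAt_rayMap (z : ℝ × ℝ) : HasFDerivAt rayMap (rayMapDeriv z) z := by
  unfold rayMapDeriv
  rw [Matrix.toLin_finTwoProd_toContinuousLinearMap]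
  convert! HasFDerivAt.prodMk (𝕜 := ℝ)
      ((hasFDerivAt_snd (𝕜 := ℝ) (p := z)).mul (hasFDerivAt_fst (𝕜 := ℝ) (p := z)))
      (hasFDerivAt_snd (𝕜 := ℝ) (p := z)) using 2
  simp

theorem det_rayMapDeriv (z : ℝ × ℝ) : (rayMapDeriv z).det = z.2 := by
  conv_lhs =>
    simp [rayMapDeriv, ContinuousLinearMap.det, Matrix.det_fin_two_of]

theorem integrableOn_upperTriangle_iff (F : ℝ × ℝ → ℝ) :
    IntegrableOn F upperTriangle ↔ IntegrableOn (fun z => z.2 * F (rayMap z)) openSquare := by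
  rw [← rayMap_image, integrableOn_image_iff_integrableOn_abs_det_fderiv_smul volume
    measurableSet_openSquare (fun z _ => (hasFDerivAt_rayMap z).hasFDerivWithinAt) injOn_rayMap F]
  refine integrableOn_congr_fun (fun z hz => ?_) measurableSet_openSquare
  simp only [det_rayMapDeriv, smul_eq_mul, abs_of_pos hz.2.1]

theorem integral_upperTriangle (F : ℝ × ℝ → ℝ) :
    ∫ x in upperTriangle, F x = ∫ z in openSquare, z.2 * F (rayMap z) := by
  rw [← rayMap_image, integral_image_eq_integral_abs_det_fderiv_smul volume
    measurableSet_openSquare (fun z _ => (hasFDerivAt_rayMap z).hasFDerivWithinAt) injOn_rayMap F]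
  refine setIntegral_congr_fun measurableSet_openSquare (fun z hz => ?_)
  simp only [det_rayMapDeriv, smul_eq_mul, abs_of_pos hz.2.1]

/-- The Jacobian of `rayMap` is the radius, which is positive on the open square, so preimages of
null sets are null. -/
theorem ae_rayMap {P : ℝ × ℝ → Prop} (h : ∀ᵐ x : ℝ × ℝ, P x) :
    ∀ᵐ z ∂(volume.restrict openSquare), P (rayMap z) := by
  set N := toMeasurable volume {x | ¬ P x} with hN
  have hN0 : volume N = 0 := by rw [hN, measure_toMeasurable]; exact h
  have hm : MeasurableSet N := measurableSet_toMeasurable _ _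
  have h1 := lintegral_image_eq_lintegral_abs_det_fderiv_mul volume
    measurableSet_openSquare (fun z _ => (hasFDerivAt_rayMap z).hasFDerivWithinAt) injOn_rayMap
    (N.indicator 1)
  have h2 : ∫⁻ x in rayMap '' openSquare, N.indicator 1 x = 0 := by
    rw [lintegral_indicator_one hm]
    exact le_antisymm ((Measure.restrict_apply_le _ _).trans hN0.le) bot_le
  rw [h2] at h1
  have hmr : Measurable rayMap := by unfold rayMap; fun_prop
  have hm2 : Measurable (fun z => ENNReal.ofReal |(rayMapDeriv z).det| *
      N.indicator 1 (rayMap z)) := by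
    simp only [det_rayMapDeriv]
    refine Measurable.mul (by fun_prop) ((measurable_one.indicator hm).comp hmr)
  have h3 := (lintegral_eq_zero_iff hm2).1 h1.symm
  filter_upwards [h3, ae_restrict_mem measurableSet_openSquare] with z hz hzs
  by_contra hP
  have hzN : rayMap z ∈ N := subset_toMeasurable _ _ hP
  have : (0 : ℝ) < z.2 := hzs.2.1
  simp [hzN, det_rayMapDeriv, this.ne'] at hz

theorem restrict_openSquare :
    (volume : Measure (ℝ × ℝ)).restrict openSquare =
      (volume.restrict (Ioo (0 : ℝ) 1)).prod (volume.restrict (Ioo (0 : ℝ) 1)) := by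
  rw [openSquare, Measure.volume_eq_prod, Measure.prod_restrict]

/-! ### Fubini on the upper triangle -/

theorem integrable_indicator_upperTriangle {F : ℝ × ℝ → ℝ} (hF : IntegrableOn F upperTriangle) :
    Integrable (upperTriangle.indicator F)
      ((volume.restrict (Ioo (0 : ℝ) 1)).prod (volume.restrict (Ioo (0 : ℝ) 1))) := by
  rw [← restrict_openSquare]
  exact ((integrable_indicator_iff measurableSet_upperTriangle).2 hF).restrict

theorem integral_indicator_upperTriangle_slice (F : ℝ × ℝ → ℝ) {t : ℝ} (ht : t ∈ Ioo (0 : ℝ) 1) :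
    ∫ y in Ioo (0 : ℝ) 1, upperTriangle.indicator F (t, y) = ∫ y in t..1, F (t, y) := by
  have : ∀ y ∈ Ioo (0 : ℝ) 1, upperTriangle.indicator F (t, y) =
      (Ioo t 1).indicator (fun y => F (t, y)) y := by
    intro y hy
    by_cases h : t < y
    · rw [indicator_of_mem, indicator_of_mem]
      · exact ⟨h, hy.2⟩
      · exact ⟨ht.1, h, hy.2⟩
    · rw [indicator_of_notMem, indicator_of_notMem]
      · exact fun h' => h h'.1
      · exact fun h' => h h'.2.1
  rw [setIntegral_congr_fun measurableSet_Ioo this, setIntegral_indicator measurableSet_Ioo,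
    inter_eq_right.2 (Ioo_subset_Ioo_left ht.1.le), intervalIntegral.integral_of_le ht.2.le,
    integral_Ioc_eq_integral_Ioo]

theorem integrableOn_slice {F : ℝ × ℝ → ℝ} (hF : IntegrableOn F upperTriangle) :
    IntegrableOn (fun t => ∫ y in t..1, F (t, y)) (Ioo 0 1) := by
  have h := (integrable_indicator_upperTriangle hF).integral_prod_left
  exact IntegrableOn.congr_fun (f := fun t => ∫ y in Ioo (0 : ℝ) 1, upperTriangle.indicator F (t, y))
    h (fun t ht => integral_indicator_upperTriangle_slice F ht) measurableSet_Ioo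

theorem integral_upperTriangle_eq_slices {F : ℝ × ℝ → ℝ} (hF : IntegrableOn F upperTriangle) :
    ∫ x in upperTriangle, F x = ∫ t in Ioo (0 : ℝ) 1, ∫ y in t..1, F (t, y) := by
  have h := integral_prod _ (integrable_indicator_upperTriangle hF)
  rw [← restrict_openSquare, setIntegral_indicator measurableSet_upperTriangle,
    inter_eq_right.2 upperTriangle_subset_openSquare] at h
  rw [h]
  exact setIntegral_congr_fun measurableSet_Ioo fun t ht =>
    integral_indicator_upperTriangle_slice F ht

/-! ### The divergence theorem on the upper triangle -/

theorem continuousOn_phi {f : ℝ × ℝ → ℝ} (hf : IsTypeDensity f) :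
    ContinuousOn (phi f) openSquare := by
  unfold phi
  exact ((hf.contDiffOn.continuousOn_fderiv_of_isOpen isOpen_openSquare le_rfl).clm_apply
    continuousOn_id).add (continuousOn_const.mul hf.contDiffOn.continuousOn)

theorem integrableOn_phi {f : ℝ × ℝ → ℝ} (hf : IsTypeDensity f) :
    IntegrableOn (phi f) openSquare := by
  obtain ⟨M, hM⟩ := hf.phi_bounded
  have hfin : volume openSquare < ⊤ := by
    rw [openSquare, Measure.volume_eq_prod, Measure.prod_prod]
    simp
  have : IsFiniteMeasure ((volume : Measure (ℝ × ℝ)).restrict openSquare) :=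
    ⟨by rwa [Measure.restrict_apply_univ]⟩
  exact Integrable.of_bound ((continuousOn_phi hf).aestronglyMeasurable measurableSet_openSquare) M
    ((ae_restrict_iff' measurableSet_openSquare).2 (Eventually.of_forall fun x hx => hM x hx))

theorem isCompact_unitSquare : IsCompact unitSquare := isCompact_Icc.prod isCompact_Icc

theorem integrableOn_mul_of_continuous {u F : ℝ × ℝ → ℝ} (hu : Continuous u)
    (hF : IntegrableOn F openSquare) : IntegrableOn (fun x => u x * F x) openSquare := by
  obtain ⟨B, hB⟩ := isCompact_unitSquare.exists_bound_of_continuousOn hu.continuousOn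
  exact hF.bdd_mul (c := B) hu.aestronglyMeasurable
    ((ae_restrict_iff' measurableSet_openSquare).2
      (Eventually.of_forall fun x hx => hB x (openSquare_subset_unitSquare hx)))

theorem integrableOn_revenue {f u : ℝ × ℝ → ℝ} {C : NNReal} (hf : IsTypeDensity f)
    (hu : LipschitzWith C u) :
    IntegrableOn (fun x => (fderiv ℝ u x x - u x) * f x) openSquare := by
  have hfi : IntegrableOn f openSquare := hf.integrable.mono_set openSquare_subset_unitSquare
  have h1 : IntegrableOn (fun x => fderiv ℝ u x x * f x) openSquare := by
    refine hfi.bdd_mul (c := C) ?_ ?_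
    · have : Measurable fun x : ℝ × ℝ => fderiv ℝ u x x :=
        (isBoundedBilinearMap_apply (𝕜 := ℝ) (E := ℝ × ℝ) (F := ℝ)).continuous.measurable.comp
          ((measurable_fderiv ℝ u).prodMk measurable_id)
      exact this.aestronglyMeasurable
    · refine (ae_restrict_iff' measurableSet_openSquare).2 (Eventually.of_forall fun x hx => ?_)
      have hx1 : ‖x‖ ≤ 1 := by
        rw [Prod.norm_def, Real.norm_eq_abs, Real.norm_eq_abs, abs_of_pos hx.1.1,
          abs_of_pos hx.2.1]
        exact max_le hx.1.2.le hx.2.2.le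
      calc ‖fderiv ℝ u x x‖ ≤ ‖fderiv ℝ u x‖ * ‖x‖ := (fderiv ℝ u x).le_opNorm x
        _ ≤ C * 1 := by
          gcongr
          exact norm_fderiv_le_of_lipschitz ℝ hu
        _ = C := mul_one _
  refine (h1.sub (integrableOn_mul_of_continuous hu.continuous hfi)).congr
    (Eventually.of_forall fun x => ?_)
  simp only [Pi.sub_apply]
  ring

theorem hasDerivAt_comp_ray {F : ℝ × ℝ → ℝ} {F' : ℝ × ℝ →L[ℝ] ℝ} {t r : ℝ}
    (h : HasFDerivAt F F' (r * t, r)) : HasDerivAt (fun r => F (r * t, r)) (F' (t, 1)) r := by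
  have hl : HasDerivAt (fun r : ℝ => (r * t, r)) (t, 1) r :=
    (by simpa using (hasDerivAt_id r).mul_const t : HasDerivAt (fun r : ℝ => r * t) t r).prodMk
      (hasDerivAt_id r)
  exact h.comp_hasDerivAt_of_eq r hl rfl

theorem clm_apply_ray (F' : ℝ × ℝ →L[ℝ] ℝ) (t r : ℝ) : F' (r * t, r) = r * F' (t, 1) := by
  rw [← smul_eq_mul r (F' (t, 1)), ← map_smul]
  simp

/-- Along the ray `x = r • (t, 1)` one has `x · ∇f = r * (d/dr) f`; the formula is the definition of
`phi` solved for the radial derivative. -/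
theorem hasDerivAt_density_ray {f : ℝ × ℝ → ℝ} (hf : IsTypeDensity f) {t r : ℝ}
    (ht : t ∈ Ioo (0 : ℝ) 1) (hr : r ∈ Ioo (0 : ℝ) 1) :
    HasDerivAt (fun r => f (r * t, r)) ((phi f (r * t, r) - 3 * f (r * t, r)) / r) r := by
  have hx : (r * t, r) ∈ openSquare :=
    ⟨⟨mul_pos hr.1 ht.1, (mul_lt_of_lt_one_right hr.1 ht.2).trans hr.2⟩, hr⟩
  have hd : HasFDerivAt f (fderiv ℝ f (r * t, r)) (r * t, r) :=
    ((hf.contDiffOn.differentiableOn one_ne_zero).differentiableAt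
      (isOpen_openSquare.mem_nhds hx)).hasFDerivAt
  have hr0 : r ≠ 0 := hr.1.ne'
  convert! hasDerivAt_comp_ray hd using 1
  rw [phi.eq_1, clm_apply_ray]
  field_simp
  ring

/-- The divergence theorem on the upper triangle, for Lipschitz utilities. The hypotenuse does not
contribute since it is a ray through the origin. -/
theorem integral_upperTriangle_revenue {f u : ℝ × ℝ → ℝ} {C : NNReal} (hf : IsTypeDensity f)
    (hu : LipschitzWith C u) :
    ∫ x in upperTriangle, (fderiv ℝ u x x - u x) * f x =
      (∫ t in Ioo (0 : ℝ) 1, u (t, 1) * f (t, 1)) - ∫ x in upperTriangle, u x * phi f x := by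
  obtain ⟨M, hM⟩ := hf.phi_bounded
  have hi1 := (integrableOn_revenue hf hu).mono_set upperTriangle_subset_openSquare
  have hi2 := (integrableOn_mul_of_continuous hu.continuous (integrableOn_phi hf)).mono_set
    upperTriangle_subset_openSquare
  rw [eq_sub_iff_add_eq, ← integral_add hi1 hi2, integral_upperTriangle, restrict_openSquare,
    integral_prod]
  swap
  · rw [← restrict_openSquare]
    exact (integrableOn_upperTriangle_iff _).1 (hi1.add hi2)
  -- Rademacher's theorem, transported to ray coordinates: on almost every ray, `u` is
  -- differentiable at almost every point, so the radial derivative there comes from the gradient.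
  have hd : ∀ᵐ t ∂(volume.restrict (Ioo (0 : ℝ) 1)), ∀ᵐ r ∂(volume.restrict (Ioo (0 : ℝ) 1)),
      DifferentiableAt ℝ u (rayMap (t, r)) := by
    have := ae_rayMap (hu.ae_differentiableAt (μ := volume))
    rw [restrict_openSquare] at this
    exact Measure.ae_ae_of_ae_prod this
  have hfi : ∀ᵐ t ∂(volume.restrict (Ioo (0 : ℝ) 1)),
      IntegrableOn (fun r => r * f (rayMap (t, r))) (Ioo 0 1) := by
    have := (integrableOn_upperTriangle_iff f).1
      (hf.integrable.mono_set (upperTriangle_subset_openSquare.trans openSquare_subset_unitSquare))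
    rw [IntegrableOn, restrict_openSquare] at this
    exact this.prod_right_ae
  refine integral_congr_ae ?_
  filter_upwards [hd, hfi, ae_restrict_mem measurableSet_Ioo] with t htd hti ht
  have hmem : ∀ r ∈ Ioo (0 : ℝ) 1, (r * t, r) ∈ openSquare := fun r hr =>
    ⟨⟨mul_pos hr.1 ht.1, (mul_lt_of_lt_one_right hr.1 ht.2).trans hr.2⟩, hr⟩
  have hray : LipschitzWith (C * 1) (fun r : ℝ => u (r * t, r)) := by
    refine hu.comp (LipschitzWith.of_dist_le_mul fun a b => ?_)
    rw [Prod.dist_eq, NNReal.coe_one, one_mul]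
    refine max_le ?_ le_rfl
    simp only [Real.dist_eq, ← sub_mul, abs_mul, abs_of_pos ht.1]
    exact mul_le_of_le_one_right (abs_nonneg _) ht.2.le
  have hcont : Continuous fun r : ℝ => (r * t, r) := by fun_prop
  have h := integral_ray (g := fun r => f (r * t, r)) (ψ := fun r => phi f (r * t, r)) hray
    (hf.continuousOn.comp hcont.continuousOn fun r hr =>
      ⟨⟨mul_pos hr.1 ht.1, mul_le_one₀ hr.2 ht.1.le ht.2.le⟩, hr⟩)
    (fun r hr => hasDerivAt_density_ray hf ht hr)
    ((continuousOn_phi hf).comp hcont.continuousOn hmem) (fun r hr => hM _ (hmem r hr)) hti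
  simp only [one_mul] at h
  rw [← h]
  refine integral_congr_ae ?_
  filter_upwards [htd] with r hr
  have h1 : deriv (fun r => u (r * t, r)) r = fderiv ℝ u (r * t, r) (t, 1) :=
    (hasDerivAt_comp_ray (HasFDerivAt.congr_fderiv hr.hasFDerivAt rfl)).deriv
  simp only [rayMap, h1, clm_apply_ray (fderiv ℝ u (r * t, r)) t r]

/-! ### Revenue of symmetric utilities -/

theorem restrict_unitSquare_eq :
    (volume : Measure (ℝ × ℝ)).restrict unitSquare = volume.restrict openSquare := by
  rw [restrict_openSquare, unitSquare, Measure.volume_eq_prod, ← Measure.prod_restrict,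
    restrict_Ioo_eq_restrict_Icc]

theorem ae_fst_ne_snd : ∀ᵐ x : ℝ × ℝ, x.1 ≠ x.2 := by
  rw [Measure.volume_eq_prod]
  refine (Measure.ae_prod_iff_ae_ae ?_).2 (Eventually.of_forall fun a => ?_)
  · exact (measurableSet_eq_fun measurable_fst measurable_snd).compl
  · have := (countable_singleton a).ae_notMem (volume : Measure ℝ)
    filter_upwards [this] with b hb
    exact fun h => hb h.symm

theorem integral_unitSquare_eq {F : ℝ × ℝ → ℝ} (hF : IntegrableOn F openSquare) :
    ∫ x in unitSquare, F x =
      (∫ x in upperTriangle, F x) + ∫ x in upperTriangle, F x.swap := by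
  have hsw : MeasurePreserving (Prod.swap : ℝ × ℝ → ℝ × ℝ) volume volume :=
    Measure.measurePreserving_swap
  have hpre : Prod.swap ⁻¹' (Prod.swap ⁻¹' upperTriangle : Set (ℝ × ℝ)) = upperTriangle := by
    ext x; simp
  have h1 : ∫ x in upperTriangle, F x.swap = ∫ x in Prod.swap ⁻¹' upperTriangle, F x := by
    rw [← hsw.setIntegral_preimage_emb MeasurableEquiv.prodComm.measurableEmbedding F
      (Prod.swap ⁻¹' upperTriangle), hpre]
  have hsub : Prod.swap ⁻¹' upperTriangle ⊆ openSquare := fun x hx =>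
    ⟨(upperTriangle_subset_openSquare hx).2, (upperTriangle_subset_openSquare hx).1⟩
  have hm : MeasurableSet (Prod.swap ⁻¹' upperTriangle : Set (ℝ × ℝ)) :=
    measurable_swap measurableSet_upperTriangle
  rw [h1, ← setIntegral_union _ hm (hF.mono_set upperTriangle_subset_openSquare)
    (hF.mono_set hsub), restrict_unitSquare_eq]
  · refine setIntegral_congr_set ?_
    filter_upwards [ae_fst_ne_snd] with x hx
    refine propext ⟨fun h => ?_, fun h => h.elim (fun h => upperTriangle_subset_openSquare h)
      (fun h => hsub h)⟩
    rcases lt_or_gt_of_ne hx with h' | h'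
    · exact Or.inl ⟨h.1.1, h', h.2.2⟩
    · exact Or.inr ⟨h.2.1, h', h.1.2⟩
  · refine disjoint_left.2 fun x hx hx' => ?_
    exact lt_asymm hx.2.1 hx'.2.1

/-- Revenue of a Lipschitz utility that is symmetric on the square, in terms of its values. -/
theorem integral_revenue_of_symmetric {f u : ℝ × ℝ → ℝ} {C : NNReal} (hf : IsSRS f)
    (hu : LipschitzWith C u) (hs : ∀ x ∈ unitSquare, u x.swap = u x) :
    ∫ x in unitSquare, (fderiv ℝ u x x - u x) * f x =
      2 * ((∫ t in Ioo (0 : ℝ) 1, u (t, 1) * f (t, 1)) -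
        ∫ x in upperTriangle, u x * phi f x) := by
  have hT : upperTriangle ⊆ unitSquare :=
    upperTriangle_subset_openSquare.trans openSquare_subset_unitSquare
  rw [integral_unitSquare_eq (integrableOn_revenue hf.toIsTypeDensity hu)]
  have hsw : LipschitzWith (C * 1) (fun x : ℝ × ℝ => u x.swap) :=
    hu.comp (LipschitzWith.of_dist_le_mul fun a b => by
      simp [Prod.dist_eq, max_comm])
  -- The lower half of the square is reflected: `f` is invariant, and the radial derivative of `u`
  -- at the reflected point is that of `u ∘ swap`, to which the divergence theorem applies.
  have h2 : ∫ x in upperTriangle, (fderiv ℝ u x.swap x.swap - u x.swap) * f x.swap =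
      ∫ x in upperTriangle, (fderiv ℝ (fun x : ℝ × ℝ => u x.swap) x x - u x.swap) * f x := by
    refine setIntegral_congr_fun measurableSet_upperTriangle fun x hx => ?_
    have : fderiv ℝ (fun x : ℝ × ℝ => u x.swap) x =
        (fderiv ℝ u x.swap).comp (ContinuousLinearEquiv.prodComm ℝ ℝ ℝ : ℝ × ℝ →L[ℝ] ℝ × ℝ) :=
      (ContinuousLinearEquiv.prodComm ℝ ℝ ℝ).comp_right_fderiv (f := u) (x := x)
    simp only [this, hf.symmetric x (hT hx)]
    rfl
  rw [h2, integral_upperTriangle_revenue hf.toIsTypeDensity hu,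
    integral_upperTriangle_revenue hf.toIsTypeDensity hsw]
  have h3 : ∫ t in Ioo (0 : ℝ) 1, u (Prod.swap (t, 1)) * f (t, 1) =
      ∫ t in Ioo (0 : ℝ) 1, u (t, 1) * f (t, 1) :=
    setIntegral_congr_fun measurableSet_Ioo fun t ht => by
      rw [hs (t, 1) ⟨Ioo_subset_Icc_self ht, zero_le_one, le_rfl⟩]
  have h4 : ∫ x in upperTriangle, u x.swap * phi f x = ∫ x in upperTriangle, u x * phi f x :=
    setIntegral_congr_fun measurableSet_upperTriangle fun x hx => by
      rw [hs x (hT hx)]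
  rw [h3, h4]
  ring

/-! ### The threshold function -/

/-- The quantity whose sign defines the threshold function `zeta`. -/
def netMargin (f : ℝ × ℝ → ℝ) (t z : ℝ) : ℝ := (∫ y in z..1, phi f (t, y)) - f (t, 1)

theorem intervalIntegrable_phi {f : ℝ × ℝ → ℝ} (hf : IsTypeDensity f) {t : ℝ}
    (ht : t ∈ Ioo (0 : ℝ) 1) {a b : ℝ} (ha : a ∈ Icc (0 : ℝ) 1) (hb : b ∈ Icc (0 : ℝ) 1) :
    IntervalIntegrable (fun y => phi f (t, y)) volume a b := by
  obtain ⟨M, hM⟩ := hf.phi_bounded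
  have h : IntegrableOn (fun y => phi f (t, y)) (Ioo 0 1) := by
    refine Integrable.of_bound (C := M) ?_ ?_
    · exact ((continuousOn_phi hf).comp (by fun_prop : Continuous fun y : ℝ => (t, y)).continuousOn
        fun y hy => ⟨ht, hy⟩).aestronglyMeasurable measurableSet_Ioo
    · exact (ae_restrict_iff' measurableSet_Ioo).2
        (Eventually.of_forall fun y hy => hM (t, y) ⟨ht, hy⟩)
  have h1 : IntervalIntegrable (fun y => phi f (t, y)) volume 0 1 :=
    (intervalIntegrable_iff_integrableOn_Ioo_of_le zero_le_one).2 h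
  refine h1.mono_set ?_
  rw [uIcc_of_le zero_le_one]
  exact ordConnected_Icc.uIcc_subset ha hb

theorem continuousOn_netMargin {f : ℝ × ℝ → ℝ} (hf : IsTypeDensity f) {t : ℝ}
    (ht : t ∈ Ioo (0 : ℝ) 1) : ContinuousOn (netMargin f t) (Icc 0 1) := by
  have h := intervalIntegrable_phi hf ht (left_mem_Icc.2 zero_le_one) (right_mem_Icc.2 zero_le_one)
  have hc := intervalIntegral.continuousOn_primitive_interval_left
      (μ := volume) (f := fun y => phi f (t, y)) (a := 0) (b := 1)
      (by rw [uIcc_of_le zero_le_one, integrableOn_Icc_iff_integrableOn_Ioc]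
          exact (intervalIntegrable_iff_integrableOn_Ioc_of_le zero_le_one).1 h)
  rw [uIcc_of_le zero_le_one] at hc
  exact hc.sub continuousOn_const

theorem ae_slice_phi_pos {f : ℝ × ℝ → ℝ} (hf : IsSRS f) :
    ∀ᵐ t ∂(volume.restrict (Ioo (0 : ℝ) 1)), ∀ᵐ y ∂(volume.restrict (Ioo (0 : ℝ) 1)),
      0 < phi f (t, y) := by
  have h := hf.strictly_regular
  rw [restrict_unitSquare_eq, restrict_openSquare] at h
  exact Measure.ae_ae_of_ae_prod h

/-- Increasing `z` removes a piece of an integral with positive integrand. The positivity of `φ` on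
the slice is available for almost every `t` only. -/
theorem netMargin_strictAntiOn {f : ℝ × ℝ → ℝ} (hf : IsTypeDensity f) {t : ℝ}
    (ht : t ∈ Ioo (0 : ℝ) 1)
    (hpos : ∀ᵐ y ∂(volume.restrict (Ioo (0 : ℝ) 1)), 0 < phi f (t, y)) :
    StrictAntiOn (netMargin f t) (Icc 0 1) := by
  intro a ha b hb hab
  have h1 : (∫ y in a..b, phi f (t, y)) + ∫ y in b..1, phi f (t, y) = ∫ y in a..1, phi f (t, y) :=
    intervalIntegral.integral_add_adjacent_intervals (intervalIntegrable_phi hf ht ha hb)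
      (intervalIntegrable_phi hf ht hb (right_mem_Icc.2 zero_le_one))
  have hp : ∀ᵐ y ∂(volume.restrict (Ioc a b)), 0 < phi f (t, y) := by
    rw [← restrict_Ioo_eq_restrict_Ioc]
    exact ae_restrict_of_ae_restrict_of_subset (Ioo_subset_Ioo ha.1 hb.2) hpos
  have h2 : 0 < ∫ y in a..b, phi f (t, y) := by
    rw [intervalIntegral.integral_of_le hab.le, setIntegral_pos_iff_support_of_nonneg_ae
      (hp.mono fun y hy => hy.le)
      ((intervalIntegrable_iff_integrableOn_Ioc_of_le hab.le).1
        (intervalIntegrable_phi hf ht ha hb))]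
    have : volume (Ioc a b) ≤ volume (Function.support (fun y => phi f (t, y)) ∩ Ioc a b) := by
      refine measure_mono_ae ?_
      filter_upwards [(ae_restrict_iff' measurableSet_Ioc).1 hp] with y hy hmem
      exact ⟨(hy hmem).ne', hmem⟩
    refine lt_of_lt_of_le ?_ this
    rw [Real.volume_Ioc]
    exact ENNReal.ofReal_pos.2 (sub_pos.2 hab)
  unfold netMargin
  linarith

theorem zeta_mem_Icc (f : ℝ × ℝ → ℝ) (t : ℝ) : zeta f t ∈ Icc (0 : ℝ) 1 :=
  ⟨Real.sSup_nonneg fun _ hz => hz.1.1, Real.sSup_le (fun _ hz => hz.1.2) zero_le_one⟩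

theorem bddAbove_zeta (f : ℝ × ℝ → ℝ) (t : ℝ) :
    BddAbove {z : ℝ | z ∈ Icc (0 : ℝ) 1 ∧ 0 ≤ (∫ x₂ in z..1, phi f (t, x₂)) - f (t, 1)} :=
  ⟨1, fun _ hz => hz.1.2⟩

theorem netMargin_neg_of_zeta_lt {f : ℝ × ℝ → ℝ} {t z : ℝ} (h : zeta f t < z) (hz : z ≤ 1) :
    netMargin f t z < 0 := by
  by_contra hcon
  exact absurd (le_csSup (bddAbove_zeta f t)
    ⟨⟨(zeta_mem_Icc f t).1.trans h.le, hz⟩, not_lt.1 hcon⟩) (not_le.2 h)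

theorem netMargin_nonpos_of_zeta_le {f : ℝ × ℝ → ℝ} (hf : IsTypeDensity f) {t z : ℝ}
    (ht : t ∈ Ioo (0 : ℝ) 1) (h : zeta f t ≤ z) (hz : z ≤ 1) : netMargin f t z ≤ 0 := by
  rcases hz.eq_or_lt with rfl | hz1
  · have : 0 ≤ f (t, 1) := hf.nonneg _ ⟨Ioo_subset_Icc_self ht, zero_le_one, le_rfl⟩
    simp [netMargin, this]
  · have hc : closure (Ioo z 1) = Icc z 1 := closure_Ioo hz1.ne
    refine le_on_closure (s := Ioo z 1) (f := netMargin f t) (g := fun _ => 0)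
      (fun y hy => (netMargin_neg_of_zeta_lt (h.trans_lt hy.1) hy.2.le).le) ?_ continuousOn_const
      (by rw [hc]; exact left_mem_Icc.2 hz)
    rw [hc]
    exact (continuousOn_netMargin hf ht).mono
      (Icc_subset_Icc_left ((zeta_mem_Icc f t).1.trans h))

theorem netMargin_pos_of_lt_zeta {f : ℝ × ℝ → ℝ} (hf : IsTypeDensity f) {t z : ℝ}
    (ht : t ∈ Ioo (0 : ℝ) 1)
    (hpos : ∀ᵐ y ∂(volume.restrict (Ioo (0 : ℝ) 1)), 0 < phi f (t, y))
    (hz : 0 ≤ z) (h : z < zeta f t) : 0 < netMargin f t z := by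
  -- An empty set would make `zeta` equal to its default `0`, which does not exceed `z`.
  have hne : {z : ℝ | z ∈ Icc (0 : ℝ) 1 ∧
      0 ≤ (∫ x₂ in z..1, phi f (t, x₂)) - f (t, 1)}.Nonempty := by
    by_contra hcon
    rw [not_nonempty_iff_eq_empty] at hcon
    rw [zeta, hcon, Real.sSup_empty] at h
    exact absurd h (not_lt.2 hz)
  obtain ⟨z', hz', hlt⟩ := exists_lt_of_lt_csSup hne h
  exact hz'.2.trans_lt
    (netMargin_strictAntiOn hf ht hpos ⟨hz, hlt.le.trans hz'.1.2⟩ hz'.1 hlt)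

/-- Follows from the strict inequality below the threshold by continuity. Positivity of `z` matters:
`zeta` can be `0` as the supremum of the empty set, and then the net margin at `0` is negative. -/
theorem netMargin_nonneg_of_le_zeta {f : ℝ × ℝ → ℝ} (hf : IsTypeDensity f) {t z : ℝ}
    (ht : t ∈ Ioo (0 : ℝ) 1)
    (hpos : ∀ᵐ y ∂(volume.restrict (Ioo (0 : ℝ) 1)), 0 < phi f (t, y))
    (hz : 0 < z) (h : z ≤ zeta f t) : 0 ≤ netMargin f t z := by
  have hc : closure (Ioo 0 z) = Icc 0 z := closure_Ioo hz.ne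
  refine le_on_closure (s := Ioo 0 z) (f := fun _ => 0) (g := netMargin f t)
    (fun y hy => (netMargin_pos_of_lt_zeta hf ht hpos hy.1.le (hy.2.trans_le h)).le)
    continuousOn_const ?_ (by rw [hc]; exact right_mem_Icc.2 hz.le)
  rw [hc]
  exact (continuousOn_netMargin hf ht).mono
    (Icc_subset_Icc_right (h.trans (zeta_mem_Icc f t).2))

/-- A nondecreasing function that is above the diagonal at `a` and below it at `b > a` crosses it
in between. -/
theorem exists_fixedPoint_of_monotoneOn {ζ : ℝ → ℝ} {a b : ℝ} (hm : MonotoneOn ζ (Icc a b))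
    (hab : a < b) (ha : a ≤ ζ a) (hb : ζ b < b) : ∃ c ∈ Ico a b, ζ c = c := by
  set S : Set ℝ := {s | s ∈ Icc a b ∧ s ≤ ζ s} with hS
  have haS : a ∈ S := ⟨left_mem_Icc.2 hab.le, ha⟩
  have hbd : BddAbove S := ⟨b, fun s hs => hs.1.2⟩
  set c := sSup S with hc
  have hac : a ≤ c := le_csSup hbd haS
  have hcb : c ≤ b := csSup_le ⟨a, haS⟩ fun s hs => hs.1.2
  have hle : c ≤ ζ c := csSup_le ⟨a, haS⟩ fun s hs =>
    hs.2.trans (hm hs.1 ⟨hac, hcb⟩ (le_csSup hbd hs))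
  have hlt : c < b := lt_of_le_of_ne hcb fun h => absurd hb (not_lt.2 (h ▸ hle))
  refine ⟨c, ⟨hac, hlt⟩, le_antisymm ?_ hle⟩
  by_contra hcon
  rw [not_le] at hcon
  have hs : c < min (ζ c) b := lt_min hcon hlt
  have hmem : min (ζ c) b ∈ Icc a b := ⟨hac.trans hs.le, min_le_right _ _⟩
  have : min (ζ c) b ∈ S :=
    ⟨hmem, (min_le_left _ _).trans (hm ⟨hac, hcb⟩ hmem hs.le)⟩
  exact absurd (le_csSup hbd this) (not_le.2 hs)

theorem integrableOn_mul_boundary {f : ℝ × ℝ → ℝ} (hf : IsTypeDensity f) {g : ℝ → ℝ}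
    (hg : Continuous g) : IntegrableOn (fun t => g t * f (t, 1)) (Ioo 0 1) := by
  obtain ⟨M, hM⟩ := hf.boundary_bounded
  obtain ⟨B, hB⟩ := (isCompact_Icc (a := (0 : ℝ)) (b := 1)).exists_bound_of_continuousOn
    hg.continuousOn
  refine Integrable.of_bound (C := B * M) ?_ ?_
  · refine ContinuousOn.aestronglyMeasurable ?_ measurableSet_Ioo
    refine hg.continuousOn.mul
      (hf.continuousOn.comp (by fun_prop : Continuous fun t : ℝ => (t, (1 : ℝ))).continuousOn ?_)
    exact fun t ht => ⟨Ioo_subset_Ioc_self ht, one_pos, le_rfl⟩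
  · refine (ae_restrict_iff' measurableSet_Ioo).2 (Eventually.of_forall fun t ht => ?_)
    have h0 : 0 ≤ f (t, 1) := hf.nonneg _ ⟨Ioo_subset_Icc_self ht, zero_le_one, le_rfl⟩
    have hb := hB t (Ioo_subset_Icc_self ht)
    rw [norm_mul, Real.norm_of_nonneg h0]
    exact mul_le_mul hb (hM t (Ioo_subset_Ioc_self ht)).1 h0 ((norm_nonneg _).trans hb)

/-- The net margin on the diagonal cannot be nonnegative up to the top of the type space. -/
theorem exists_netMargin_diagonal_neg {f : ℝ × ℝ → ℝ} (hf : IsSRS f) {t₀ : ℝ}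
    (ht₀ : t₀ ∈ Ioo (0 : ℝ) 1) : ∃ t ∈ Ioo t₀ 1,
      (∀ᵐ y ∂(volume.restrict (Ioo (0 : ℝ) 1)), 0 < phi f (t, y)) ∧ netMargin f t t < 0 := by
  by_contra! hcon
  -- Test utility: by the divergence theorem its revenue on the triangle is `-∫ max (t - t₀) 0 *
  -- netMargin f t t dt`, which `hcon` makes nonpositive. Directly, the revenue is `t₀` times the
  -- mass of the types with `x₁ > t₀`. So `f`, and with it `φ`, vanishes on an open set, against
  -- strict regularity.
  set u : ℝ × ℝ → ℝ := fun x => max (x.1 - t₀) 0 with hu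
  have hul : LipschitzWith 1 u := by
    have h1 : LipschitzWith 1 fun x : ℝ × ℝ => x.1 - t₀ :=
      LipschitzWith.of_dist_le_mul fun x y => by
        simp [Real.dist_eq, Prod.dist_eq]
    simpa using h1.max_const 0
  have hd := integral_upperTriangle_revenue hf.toIsTypeDensity hul
  have hui := (integrableOn_mul_of_continuous hul.continuous
    (integrableOn_phi hf.toIsTypeDensity)).mono_set upperTriangle_subset_openSquare
  have hdi := (integrableOn_revenue hf.toIsTypeDensity hul).mono_set
    upperTriangle_subset_openSquare
  have hfi : IntegrableOn (fun t => u (t, 1) * f (t, 1)) (Ioo 0 1) :=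
    integrableOn_mul_boundary hf.toIsTypeDensity (g := fun t => u (t, 1))
      (hul.continuous.comp (by fun_prop))
  have hle : ∫ x in upperTriangle, (fderiv ℝ u x x - u x) * f x ≤ 0 := by
    rw [hd, integral_upperTriangle_eq_slices hui, ← integral_sub hfi (integrableOn_slice hui)]
    refine setIntegral_nonpos_of_ae_restrict ?_
    filter_upwards [ae_slice_phi_pos hf, ae_restrict_mem measurableSet_Ioo] with t hpos ht
    simp only [hu, Pi.zero_apply, intervalIntegral.integral_const_mul]
    rcases le_or_gt t t₀ with h | h
    · simp [max_eq_right (sub_nonpos.2 h)]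
    · have := hcon t ⟨h, ht.2⟩ hpos
      unfold netMargin at this
      have h0 : 0 ≤ max (t - t₀) 0 := le_max_right _ _
      nlinarith
  have hval : ∀ x ∈ upperTriangle, (fderiv ℝ u x x - u x) * f x =
      t₀ * ({x : ℝ × ℝ | t₀ < x.1}.indicator f x) := by
    intro x hx
    by_cases h : t₀ < x.1
    · have hev : u =ᶠ[𝓝 x] fun x => x.1 - t₀ := by
        filter_upwards [(isOpen_lt continuous_const continuous_fst).mem_nhds h] with y hy
        exact max_eq_left (sub_nonneg.2 (le_of_lt hy))
      have hfd : fderiv ℝ u x = ContinuousLinearMap.fst ℝ ℝ ℝ := by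
        rw [hev.fderiv_eq, fderiv_sub_const]
        exact fderiv_fst
      rw [hfd, hev.eq_of_nhds, indicator_of_mem (by exact h)]
      simp
    -- These points are minima of `u`. This covers the kink `x.1 = t₀`, where `fderiv` takes its
    -- default value zero.
    · have hux : u x = 0 := max_eq_right (sub_nonpos.2 (not_lt.1 h))
      have hmin : IsLocalMin u x :=
        Eventually.of_forall fun y => by rw [hux]; exact le_max_right _ _
      rw [hmin.fderiv_eq_zero, hux, indicator_of_notMem (by exact h)]
      simp
  set V : Set (ℝ × ℝ) := upperTriangle ∩ {x | t₀ < x.1} with hV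
  have hVo : IsOpen V := isOpen_upperTriangle.inter (isOpen_lt continuous_const continuous_fst)
  have hVs : V ⊆ openSquare := inter_subset_left.trans upperTriangle_subset_openSquare
  have hf0 : ∀ x ∈ upperTriangle, 0 ≤ f x := fun x hx =>
    hf.nonneg x (openSquare_subset_unitSquare (upperTriangle_subset_openSquare hx))
  have hnn : 0 ≤ᵐ[volume.restrict upperTriangle]
      fun x => (fderiv ℝ u x x - u x) * f x := by
    refine (ae_restrict_iff' measurableSet_upperTriangle).2 (Eventually.of_forall fun x hx => ?_)
    simp only [hval x hx, Pi.zero_apply]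
    exact mul_nonneg ht₀.1.le (indicator_apply_nonneg fun _ => hf0 x hx)
  have hz := (setIntegral_eq_zero_iff_of_nonneg_ae hnn hdi).1
    (le_antisymm hle (integral_nonneg_of_ae hnn))
  have hfz : f =ᵐ[volume.restrict V] 0 := by
    have := ae_restrict_of_ae_restrict_of_subset (inter_subset_left : V ⊆ upperTriangle) hz
    filter_upwards [this, ae_restrict_mem hVo.measurableSet] with x hx hxV
    rw [hval x hxV.1, indicator_of_mem hxV.2] at hx
    exact (mul_eq_zero.1 hx).resolve_left ht₀.1.ne'
  have hfz' : EqOn f 0 V := Measure.eqOn_open_of_ae_eq hfz hVo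
    (hf.contDiffOn.continuousOn.mono hVs) continuousOn_const
  have hphi : ∀ x ∈ V, phi f x = 0 := by
    intro x hx
    have hev : f =ᶠ[𝓝 x] fun _ => 0 := by
      filter_upwards [hVo.mem_nhds hx] with y hy using hfz' hy
    rw [phi, hev.fderiv_eq, hev.eq_of_nhds]
    simp
  have hsr := ae_restrict_of_ae_restrict_of_subset
    (hVs.trans openSquare_subset_unitSquare) hf.strictly_regular
  have hfalse : ∀ᵐ x ∂((volume : Measure (ℝ × ℝ)).restrict V), False := by
    filter_upwards [hsr, ae_restrict_mem hVo.measurableSet] with x hx hxV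
    exact hx.ne' (hphi x hxV)
  have hV0 : volume V = 0 := by
    rw [← Measure.restrict_eq_zero]
    simpa using hfalse
  have hne : V.Nonempty := by
    refine ⟨(t₀ + (1 - t₀) / 3, t₀ + (1 - t₀) / 2), ⟨?_, ?_, ?_⟩, ?_⟩
    all_goals
      simp only [mem_ofPred_eq]
      linarith [ht₀.1, ht₀.2]
  exact (hVo.measure_pos volume hne).ne' hV0

/-- A single crossing alone does not fix the direction. If `ζ` were on or above the diagonal at `t`,
it would still fall below it at some later point by `exists_netMargin_diagonal_neg`, and a monotone
function cannot do so without a second crossing. -/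
theorem zeta_lt_self_of_gt_crossing {f : ℝ × ℝ → ℝ} (hf : IsSRS f)
    (hmono : MonotoneOn (zeta f) (Ioo 0 1)) {a : ℝ} (ha : a ∈ Ioo (0 : ℝ) 1)
    (huniq : ∀ x ∈ Ioo (0 : ℝ) 1, zeta f x = x → x = a) {t : ℝ} (hat : a < t) (ht : t < 1) :
    zeta f t < t := by
  by_contra hcon
  obtain ⟨s, hs, hpos, hneg⟩ := exists_netMargin_diagonal_neg hf ⟨ha.1.trans hat, ht⟩
  have hs0 : s ∈ Ioo (0 : ℝ) 1 := ⟨ha.1.trans (hat.trans hs.1), hs.2⟩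
  have hlt : zeta f s < s := by
    by_contra h
    exact absurd (netMargin_nonneg_of_le_zeta hf.toIsTypeDensity hs0 hpos hs0.1 (not_lt.1 h))
      (not_le.2 hneg)
  obtain ⟨c, hc, hfix⟩ := exists_fixedPoint_of_monotoneOn
    (hmono.mono fun x hx => ⟨ha.1.trans (hat.trans_le hx.1), hx.2.trans_lt hs.2⟩)
    hs.1 (not_lt.1 hcon) hlt
  exact absurd (huniq c ⟨ha.1.trans (hat.trans_le hc.1), hc.2.trans hs0.2⟩ hfix)
    (hat.trans_le hc.1).ne'

/-! ### The one-dimensional problem on the boundary -/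

/-- The contribution to revenue of the types `(t, y)`, `t < y < 1`, when the boundary type
`(t, 1)` has utility `s` and the others the least utility compatible with this. -/
def sliceRevenue (f : ℝ × ℝ → ℝ) (t s : ℝ) : ℝ :=
  s * f (t, 1) - ∫ y in t..1, max (s + y - 1) 0 * phi f (t, y)

theorem intervalIntegrable_utility_mul_phi {f : ℝ × ℝ → ℝ} (hf : IsTypeDensity f) {t : ℝ}
    (ht : t ∈ Ioo (0 : ℝ) 1) (s : ℝ) {a b : ℝ} (ha : a ∈ Icc (0 : ℝ) 1) (hb : b ∈ Icc (0 : ℝ) 1) :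
    IntervalIntegrable (fun y => max (s + y - 1) 0 * phi f (t, y)) volume a b :=
  (intervalIntegrable_phi hf ht ha hb).continuousOn_mul (by fun_prop)

/-- Concavity of the slice revenue in the boundary utility. -/
theorem sliceRevenue_le {f : ℝ × ℝ → ℝ} (hf : IsTypeDensity f) {t : ℝ} (ht : t ∈ Ioo (0 : ℝ) 1)
    (hpos : ∀ᵐ y ∂(volume.restrict (Ioo (0 : ℝ) 1)), 0 < phi f (t, y)) {s : ℝ} (hs : 0 ≤ s)
    (s' : ℝ) :
    sliceRevenue f t s' ≤ sliceRevenue f t s - (s' - s) * netMargin f t (max t (1 - s)) := by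
  -- Slice types below `z` have utility zero at `s`, those above have utility `s + y - 1`. The
  -- inequality integrates the tangent bound for `max · 0` with slope 0 below `z` and slope 1 above
  -- it.
  set z := max t (1 - s) with hz
  have htz : t ≤ z := le_max_left _ _
  have hz1 : z ≤ 1 := max_le ht.2.le (by linarith)
  have htI : t ∈ Icc (0 : ℝ) 1 := Ioo_subset_Icc_self ht
  have hzI : z ∈ Icc (0 : ℝ) 1 := ⟨ht.1.le.trans htz, hz1⟩
  have h1I : (1 : ℝ) ∈ Icc (0 : ℝ) 1 := right_mem_Icc.2 zero_le_one
  have hsplit : ∀ σ : ℝ, ∫ y in t..1, max (σ + y - 1) 0 * phi f (t, y) =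
      (∫ y in t..z, max (σ + y - 1) 0 * phi f (t, y)) +
        ∫ y in z..1, max (σ + y - 1) 0 * phi f (t, y) := fun σ =>
    (intervalIntegral.integral_add_adjacent_intervals
      (intervalIntegrable_utility_mul_phi hf ht σ htI hzI)
      (intervalIntegrable_utility_mul_phi hf ht σ hzI h1I)).symm
  have hae : ∀ {a b : ℝ}, 0 ≤ a → b ≤ 1 →
      ∀ᵐ y ∂(volume.restrict (Icc a b)), y ∈ Icc a b ∧ 0 < phi f (t, y) := by
    intro a b ha hb
    rw [restrict_Ioo_eq_restrict_Icc] at hpos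
    filter_upwards [ae_restrict_of_ae_restrict_of_subset (Icc_subset_Icc ha hb) hpos,
      ae_restrict_mem measurableSet_Icc] with y h h' using ⟨h', h⟩
  have hlow : ∫ y in t..z, max (s + y - 1) 0 * phi f (t, y) ≤
      ∫ y in t..z, max (s' + y - 1) 0 * phi f (t, y) := by
    refine intervalIntegral.integral_mono_ae_restrict htz
      (intervalIntegrable_utility_mul_phi hf ht s htI hzI)
      (intervalIntegrable_utility_mul_phi hf ht s' htI hzI) ?_
    rcases htz.eq_or_lt with h | h
    · simp [← h, EventuallyLE]
    · have hz' : z = 1 - s := by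
        rcases max_choice t (1 - s) with h' | h'
        · exact absurd (hz.trans h') h.ne'
        · exact hz.trans h'
      filter_upwards [hae ht.1.le hz1] with y hy
      refine mul_le_mul_of_nonneg_right ?_ hy.2.le
      rw [max_eq_right (by linarith [hy.1.2])]
      exact le_max_right _ _
  have hup : ∫ y in z..1, (max (s + y - 1) 0 * phi f (t, y) + (s' - s) * phi f (t, y)) ≤
      ∫ y in z..1, max (s' + y - 1) 0 * phi f (t, y) := by
    refine intervalIntegral.integral_mono_ae_restrict hz1
      ((intervalIntegrable_utility_mul_phi hf ht s hzI h1I).add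
        ((intervalIntegrable_phi hf ht hzI h1I).const_mul _))
      (intervalIntegrable_utility_mul_phi hf ht s' hzI h1I) ?_
    filter_upwards [hae hzI.1 le_rfl] with y hy
    rw [← add_mul]
    refine mul_le_mul_of_nonneg_right ?_ hy.2.le
    rw [max_eq_left (by linarith [hy.1.1, le_max_right t (1 - s)])]
    exact le_trans (by linarith) (le_max_left _ _)
  rw [intervalIntegral.integral_add (intervalIntegrable_utility_mul_phi hf ht s hzI h1I)
    ((intervalIntegrable_phi hf ht hzI h1I).const_mul _),
    intervalIntegral.integral_const_mul] at hup
  rw [sliceRevenue, sliceRevenue, hsplit s, hsplit s', netMargin]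
  nlinarith

/-- Raising the boundary utility is profitable below the threshold. -/
theorem sliceRevenue_lt_of_lt {f : ℝ × ℝ → ℝ} (hf : IsTypeDensity f) {t : ℝ}
    (ht : t ∈ Ioo (0 : ℝ) 1)
    (hpos : ∀ᵐ y ∂(volume.restrict (Ioo (0 : ℝ) 1)), 0 < phi f (t, y)) {s w : ℝ} (hs : 0 ≤ s)
    (hsw : s < w) (h : zeta f t < t ∨ w ≤ 1 - zeta f t) :
    sliceRevenue f t s < sliceRevenue f t w := by
  -- The slope at `w` may vanish, since `w` may be the peak; going through the midpoint of `s` and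
  -- `w`, where the slope is nonzero, gives strictness.
  have h1 := sliceRevenue_le hf ht hpos (s := (s + w) / 2) (by linarith) s
  have h2 := sliceRevenue_le hf ht hpos (s := w) (by linarith) ((s + w) / 2)
  have h3 : netMargin f t (max t (1 - (s + w) / 2)) < 0 := by
    refine netMargin_neg_of_zeta_lt ?_ (max_le ht.2.le (by linarith))
    rcases h with h | h
    · exact h.trans_le (le_max_left _ _)
    · exact lt_of_lt_of_le (by linarith) (le_max_right _ _)
  have h4 : netMargin f t (max t (1 - w)) ≤ 0 := by
    refine netMargin_nonpos_of_zeta_le hf ht ?_ (max_le ht.2.le (by linarith))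
    rcases h with h | h
    · exact h.le.trans (le_max_left _ _)
    · exact le_trans (by linarith) (le_max_right _ _)
  nlinarith

/-- Lowering the boundary utility is profitable above the threshold. -/
theorem sliceRevenue_lt_of_gt {f : ℝ × ℝ → ℝ} (hf : IsTypeDensity f) {t : ℝ}
    (ht : t ∈ Ioo (0 : ℝ) 1)
    (hpos : ∀ᵐ y ∂(volume.restrict (Ioo (0 : ℝ) 1)), 0 < phi f (t, y)) {s w : ℝ} (hw : 0 ≤ w)
    (hws : w < s) (h : t < zeta f t) (h' : 1 - zeta f t ≤ w) :
    sliceRevenue f t s < sliceRevenue f t w := by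
  have h1 := sliceRevenue_le hf ht hpos (s := (s + w) / 2) (by linarith) s
  have h2 := sliceRevenue_le hf ht hpos (s := w) hw ((s + w) / 2)
  have h3 : 0 < netMargin f t (max t (1 - (s + w) / 2)) :=
    netMargin_pos_of_lt_zeta hf ht hpos (ht.1.le.trans (le_max_left _ _))
      (max_lt h (by linarith))
  have h4 : 0 ≤ netMargin f t (max t (1 - w)) :=
    netMargin_nonneg_of_le_zeta hf ht hpos (ht.1.trans_le (le_max_left _ _))
      (max_le h.le (by linarith))
  nlinarith

/-- The point at which the boundary utility `g` meets the target `1 - ζ`. -/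
theorem exists_switching_point {ζ g : ℝ → ℝ} {a : ℝ} (ha : a ∈ Ioo (0 : ℝ) 1)
    (hm : MonotoneOn ζ (Ioo 0 1)) (hne : ∀ x ∈ Ioo 0 a, ζ x ≠ x)
    (hg : MonotoneOn g (Icc 0 1)) (hgc : ContinuousOn g (Icc 0 1)) :
    ∃ d ∈ Icc 0 a, (∀ t ∈ Ioo 0 d, ζ t < t ∨ g d ≤ 1 - ζ t) ∧
      ∀ t ∈ Ioo d a, t < ζ t ∧ 1 - ζ t ≤ g d := by
  -- These are the points left of the crossing where raising `g` pays; the switching point is their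
  -- supremum, or `0` if there are none.
  set A : Set ℝ := {t | t ∈ Ioo 0 a ∧ (ζ t < t ∨ g t < 1 - ζ t)} with hA
  have hsub : Ioo 0 a ⊆ Ioo 0 1 := Ioo_subset_Ioo_right ha.2.le
  have hbd : BddAbove A := ⟨a, fun t ht => ht.1.2.le⟩
  -- Being below the diagonal propagates to the left, since otherwise `ζ` would cross it before `a`.
  have hfirst : ∀ s ∈ Ioo 0 a, ∀ t ∈ Ioo 0 a, s < t → ζ t < t → ζ s < s := by
    intro s hs t ht hst h
    by_contra hcon
    obtain ⟨c, hc, hfix⟩ := exists_fixedPoint_of_monotoneOn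
      (hm.mono fun x hx => ⟨hs.1.trans_le hx.1, hx.2.trans_lt (ht.2.trans ha.2)⟩)
      hst (not_lt.1 hcon) h
    exact hne c ⟨hs.1.trans_le hc.1, hc.2.trans ht.2⟩ hfix
  have hd0 : 0 ≤ sSup A := Real.sSup_nonneg fun t ht => ht.1.1.le
  have hda : sSup A ≤ a := Real.sSup_le (fun t ht => ht.1.2.le) ha.1.le
  have hdI : sSup A ∈ Icc (0 : ℝ) 1 := ⟨hd0, hda.trans ha.2.le⟩
  refine ⟨sSup A, ⟨hd0, hda⟩, fun t ht => ?_, fun t ht => ?_⟩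
  · have hta : t ∈ Ioo 0 a := ⟨ht.1, ht.2.trans_le hda⟩
    rw [or_iff_not_imp_left]
    intro hnot
    refine le_on_closure (s := Ioo t (sSup A)) (f := g) (g := fun _ => 1 - ζ t) (fun x hx => ?_)
      ?_ continuousOn_const (x := sSup A) ?_
    · have hAne : A.Nonempty := by
        by_contra hcon
        rw [not_nonempty_iff_eq_empty] at hcon
        rw [hcon, Real.sSup_empty] at ht
        exact lt_asymm ht.1 ht.2
      obtain ⟨y, hy, hxy⟩ := exists_lt_of_lt_csSup hAne hx.2
      have hty : t < y := hx.1.trans hxy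
      rcases hy.2 with h | h
      · exact absurd (hfirst t hta y hy.1 hty h) hnot
      · have h1 : ζ t ≤ ζ y := hm (hsub hta) (hsub hy.1) hty.le
        have h2 : g x ≤ g y := hg ⟨ht.1.le.trans hx.1.le, hx.2.le.trans hdI.2⟩
          (Ioo_subset_Icc_self (hsub hy.1)) hxy.le
        linarith
    · rw [closure_Ioo ht.2.ne]
      exact hgc.mono (Icc_subset_Icc ht.1.le hdI.2)
    · rw [closure_Ioo ht.2.ne]
      exact right_mem_Icc.2 ht.2.le
  · have hta : t ∈ Ioo 0 a := ⟨hd0.trans_lt ht.1, ht.2⟩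
    have hnot : ∀ x ∈ Ioc (sSup A) t, x ≤ ζ x ∧ 1 - ζ x ≤ g x := by
      intro x hx
      have hxA : x ∉ A := fun h => absurd (le_csSup hbd h) (not_le.2 hx.1)
      have hxa : x ∈ Ioo 0 a := ⟨hd0.trans_lt hx.1, hx.2.trans_lt ht.2⟩
      by_contra hcon
      refine hxA ⟨hxa, ?_⟩
      by_contra hcon'
      push Not at hcon'
      exact hcon hcon'
    refine ⟨lt_of_le_of_ne (hnot t ⟨ht.1, le_rfl⟩).1 (hne t hta).symm, ?_⟩
    refine le_on_closure (s := Ioo (sSup A) t) (f := fun _ => 1 - ζ t) (g := g) (fun x hx => ?_)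
      continuousOn_const ?_ (x := sSup A) ?_
    · have h1 := (hnot x ⟨hx.1, hx.2.le⟩).2
      have h2 : ζ x ≤ ζ t := hm (hsub ⟨hd0.trans_lt hx.1, hx.2.trans ht.2⟩) (hsub hta) hx.2.le
      linarith
    · rw [closure_Ioo ht.1.ne]
      exact hgc.mono (Icc_subset_Icc hd0 (hsub hta).2.le)
    · rw [closure_Ioo ht.1.ne]
      exact left_mem_Icc.2 ht.1.le

/-! ### Indirect utilities -/

theorem bddAbove_indirectUtility {p : ℝ × ℝ → ℝ} (hp : IsPriceSchedule p) (x : ℝ × ℝ) :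
    BddAbove ((fun q => dot x q - p q) '' unitSquare) := by
  obtain ⟨b, hb⟩ := hp.bddBelow
  refine ⟨|x.1| + |x.2| - b, ?_⟩
  rintro _ ⟨q, hq, rfl⟩
  have h1 : b ≤ p q := hb (mem_image_of_mem p hq)
  have h2 : x.1 * q.1 ≤ |x.1| :=
    (mul_le_mul_of_nonneg_right (le_abs_self _) hq.1.1).trans
      (mul_le_of_le_one_right (abs_nonneg _) hq.1.2)
  have h3 : x.2 * q.2 ≤ |x.2| :=
    (mul_le_mul_of_nonneg_right (le_abs_self _) hq.2.1).trans
      (mul_le_of_le_one_right (abs_nonneg _) hq.2.2)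
  simp only [dot]
  linarith

theorem zero_mem_unitSquare : ((0, 0) : ℝ × ℝ) ∈ unitSquare := by
  simp [unitSquare]

theorem le_indirectUtility {p : ℝ × ℝ → ℝ} (hp : IsPriceSchedule p) (x : ℝ × ℝ) {q : ℝ × ℝ}
    (hq : q ∈ unitSquare) : dot x q - p q ≤ indirectUtility p x :=
  le_csSup (bddAbove_indirectUtility hp x) ⟨q, hq, rfl⟩

theorem indirectUtility_le {p : ℝ × ℝ → ℝ} {x : ℝ × ℝ} {b : ℝ}
    (h : ∀ q ∈ unitSquare, dot x q - p q ≤ b) : indirectUtility p x ≤ b :=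
  csSup_le (Nonempty.image _ ⟨_, zero_mem_unitSquare⟩) (by rintro _ ⟨q, hq, rfl⟩; exact h q hq)

theorem indirectUtility_nonneg {p : ℝ × ℝ → ℝ} (hp : IsPriceSchedule p) (x : ℝ × ℝ) :
    0 ≤ indirectUtility p x := by
  simpa [dot, hp.zero_bundle] using le_indirectUtility hp x zero_mem_unitSquare

/-- The indirect utility is nondecreasing and grows at most at unit rate in each coordinate. -/
theorem indirectUtility_le_add {p : ℝ × ℝ → ℝ} (hp : IsPriceSchedule p) (x y : ℝ × ℝ) :
    indirectUtility p x ≤ indirectUtility p y + max (x.1 - y.1) 0 + max (x.2 - y.2) 0 := by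
  refine indirectUtility_le fun q hq => ?_
  have h := le_indirectUtility hp y hq
  have key : ∀ a s : ℝ, 0 ≤ s → s ≤ 1 → a * s ≤ max a 0 := fun a s hs hs1 =>
    (mul_le_mul_of_nonneg_right (le_max_left a 0) hs).trans
      (mul_le_of_le_one_right (le_max_right _ _) hs1)
  have h1 := key (x.1 - y.1) q.1 hq.1.1 hq.1.2
  have h2 := key (x.2 - y.2) q.2 hq.2.1 hq.2.2
  simp only [dot] at h ⊢
  linarith

theorem lipschitzWith_indirectUtility {p : ℝ × ℝ → ℝ} (hp : IsPriceSchedule p) :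
    LipschitzWith 2 (indirectUtility p) := by
  refine LipschitzWith.of_le_add_mul 2 fun x y => ?_
  have h := indirectUtility_le_add hp x y
  have h1 : max (x.1 - y.1) 0 ≤ dist x y :=
    max_le ((le_abs_self _).trans (le_max_left _ _)) dist_nonneg
  have h2 : max (x.2 - y.2) 0 ≤ dist x y :=
    max_le ((le_abs_self _).trans (le_max_right _ _)) dist_nonneg
  simp only [NNReal.coe_ofNat]
  linarith

theorem continuous_boundaryUtility {p : ℝ × ℝ → ℝ} (hp : IsPriceSchedule p) :
    Continuous (boundaryUtility p) :=
  (lipschitzWith_indirectUtility hp).continuous.comp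
    (by fun_prop : Continuous fun t : ℝ => (t, (1 : ℝ)))

theorem boundaryUtility_le_add {p : ℝ × ℝ → ℝ} (hp : IsPriceSchedule p) (s t : ℝ) :
    boundaryUtility p s ≤ boundaryUtility p t + max (s - t) 0 := by
  simpa [boundaryUtility] using indirectUtility_le_add hp (s, 1) (t, 1)

theorem monotone_boundaryUtility {p : ℝ × ℝ → ℝ} (hp : IsPriceSchedule p) :
    Monotone (boundaryUtility p) := fun s t hst => by
  have := boundaryUtility_le_add hp s t
  rwa [max_eq_right (sub_nonpos.2 hst), add_zero] at this

theorem boundaryUtility_sub_le {p : ℝ × ℝ → ℝ} (hp : IsPriceSchedule p) {s t : ℝ} (hst : s ≤ t) :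
    boundaryUtility p t - boundaryUtility p s ≤ t - s := by
  have := boundaryUtility_le_add hp t s
  rw [max_eq_left (sub_nonneg.2 hst)] at this
  linarith

/-- The least utility compatible with the boundary utility. -/
theorem lower_bound_indirectUtility {p : ℝ × ℝ → ℝ} (hp : IsPriceSchedule p) {x : ℝ × ℝ}
    (hx : x.2 ≤ 1) : max (boundaryUtility p x.1 + x.2 - 1) 0 ≤ indirectUtility p x := by
  refine max_le ?_ (indirectUtility_nonneg hp x)
  have := indirectUtility_le_add hp (x.1, 1) x
  simp only [sub_self, max_self, add_zero, max_eq_left (sub_nonneg.2 hx)] at this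
  unfold boundaryUtility
  linarith

/-! ### Deterministic menus -/

open Classical in
/-- The symmetric menu selling one good at price `1 - c` and the bundle at price `1 - k`. -/
def menuPrice (c k : ℝ) (q : ℝ × ℝ) : ℝ :=
  if q = (0, 0) then 0
  else if q = (0, 1) ∨ q = (1, 0) then 1 - c
  else if q = (1, 1) then 1 - k
  else 2

/-- The indirect utility of the menu on the type space. -/
def menuUtility (c k : ℝ) (x : ℝ × ℝ) : ℝ :=
  max (max 0 (c + x.2 - 1)) (max (c + x.1 - 1) (x.1 + x.2 - 1 + k))

theorem isPriceSchedule_menuPrice (c k : ℝ) : IsPriceSchedule (menuPrice c k) where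
  zero_bundle := by simp [menuPrice]
  bddBelow := by
    refine ⟨min 0 (min (1 - c) (1 - k)), ?_⟩
    rintro _ ⟨q, -, rfl⟩
    unfold menuPrice
    split_ifs
    · exact min_le_left _ _
    · exact (min_le_right _ _).trans (min_le_left _ _)
    · exact (min_le_right _ _).trans (min_le_right _ _)
    · exact (min_le_left _ _).trans zero_le_two

theorem indirectUtility_menuPrice (c k : ℝ) {x : ℝ × ℝ} (hx : x ∈ unitSquare) :
    indirectUtility (menuPrice c k) x = menuUtility c k x := by
  have hp := isPriceSchedule_menuPrice c k
  refine le_antisymm (indirectUtility_le fun q hq => ?_) ?_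
  · by_cases h0 : q = (0, 0)
    · subst h0
      simp [menuPrice, menuUtility, dot]
    by_cases h1 : q = (0, 1)
    · subst h1
      refine le_trans (le_of_eq ?_) ((le_max_right _ _).trans (le_max_left _ _))
      simp [menuPrice, dot]
      ring
    by_cases h2 : q = (1, 0)
    · subst h2
      refine le_trans (le_of_eq ?_) ((le_max_left _ _).trans (le_max_right _ _))
      simp [menuPrice, dot]
      ring
    by_cases h3 : q = (1, 1)
    · subst h3
      refine le_trans (le_of_eq ?_) ((le_max_right _ _).trans (le_max_right _ _))
      simp [menuPrice, dot]
      ring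
    · refine le_trans ?_ ((le_max_left _ _).trans (le_max_left _ _))
      -- On the square `x · q ≤ 2`, so a bundle priced at `2` never beats the zero bundle.
      have h4 := mul_le_one₀ hx.1.2 hq.1.1 hq.1.2
      have h5 := mul_le_one₀ hx.2.2 hq.2.1 hq.2.2
      simp only [menuPrice, h0, h1, h2, h3, dot, or_self, if_false]
      linarith
  · refine max_le (max_le (indirectUtility_nonneg hp x) ?_) (max_le ?_ ?_)
    · refine le_trans (le_of_eq ?_) (le_indirectUtility hp x (q := (0, 1)) (by simp [unitSquare]))
      simp [menuPrice, dot]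
      ring
    · refine le_trans (le_of_eq ?_) (le_indirectUtility hp x (q := (1, 0)) (by simp [unitSquare]))
      simp [menuPrice, dot]
      ring
    · refine le_trans (le_of_eq ?_) (le_indirectUtility hp x (q := (1, 1)) (by simp [unitSquare]))
      simp [menuPrice, dot]
      ring

theorem menuUtility_swap (c k : ℝ) (x : ℝ × ℝ) : menuUtility c k x.swap = menuUtility c k x := by
  simp only [menuUtility, Prod.fst_swap, Prod.snd_swap, max_assoc]
  rw [max_left_comm (c + x.1 - 1), add_comm x.2 x.1]

/-- Above the diagonal, good 1 alone is dominated by good 2 alone. With `menuUtility_boundary`, this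
says that the menu attains the least utility compatible with its boundary values there. -/
theorem menuUtility_of_le (c k : ℝ) {x : ℝ × ℝ} (hx : x.1 ≤ x.2) :
    menuUtility c k x = max (max c (x.1 + k) + x.2 - 1) 0 := by
  unfold menuUtility
  rw [← max_add_add_right, ← max_sub_sub_right]
  have h1 : c + x.1 - 1 ≤ c + x.2 - 1 := by linarith
  have h2 : x.1 + x.2 - 1 + k = x.1 + k + x.2 - 1 := by ring
  rw [h2]
  apply le_antisymm
  · refine max_le (max_le (le_max_right _ _) ((le_max_left _ _).trans (le_max_left _ _)))
      (max_le (h1.trans ((le_max_left _ _).trans (le_max_left _ _)))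
        ((le_max_right _ _).trans (le_max_left _ _)))
  · refine max_le (max_le ((le_max_right _ _).trans (le_max_left _ _))
      ((le_max_right _ _).trans (le_max_right _ _))) ((le_max_left _ _).trans (le_max_left _ _))

theorem menuUtility_boundary {c : ℝ} (hc : 0 ≤ c) (k : ℝ) {t : ℝ} (ht : t ≤ 1) :
    menuUtility c k (t, 1) = max c (t + k) := by
  rw [menuUtility_of_le c k (by exact ht)]
  simp only [add_sub_cancel_right]
  exact max_eq_left (hc.trans (le_max_left _ _))

theorem continuous_menuUtility (c k : ℝ) : Continuous (menuUtility c k) := by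
  unfold menuUtility
  fun_prop

/-! ### Comparison of an optimal mechanism with a menu -/

theorem totalRevenue_eq {f p : ℝ × ℝ → ℝ} (hf : IsSRS f) (hp : IsPriceSchedule p)
    (hs : IsSymmetric p) :
    totalRevenue f p = 2 * ((∫ t in Ioo (0 : ℝ) 1, boundaryUtility p t * f (t, 1)) -
      ∫ x in upperTriangle, indirectUtility p x * phi f x) :=
  integral_revenue_of_symmetric hf (lipschitzWith_indirectUtility hp) hs

theorem integrableOn_continuous_mul_phi {f u : ℝ × ℝ → ℝ} (hf : IsTypeDensity f)
    (hu : Continuous u) : IntegrableOn (fun x => u x * phi f x) upperTriangle :=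
  (integrableOn_mul_of_continuous hu (integrableOn_phi hf)).mono_set upperTriangle_subset_openSquare

theorem integrableOn_sliceRevenue {f : ℝ × ℝ → ℝ} (hf : IsTypeDensity f) {g : ℝ → ℝ}
    (hg : Continuous g) : IntegrableOn (fun t => sliceRevenue f t (g t)) (Ioo 0 1) :=
  (integrableOn_mul_boundary hf hg).sub
    (integrableOn_slice (F := fun x => max (g x.1 + x.2 - 1) 0 * phi f x)
      (integrableOn_continuous_mul_phi hf (by fun_prop)))

theorem integral_sliceRevenue {f : ℝ × ℝ → ℝ} (hf : IsTypeDensity f) {g : ℝ → ℝ}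
    (hg : Continuous g) : ∫ t in Ioo (0 : ℝ) 1, sliceRevenue f t (g t) =
      (∫ t in Ioo (0 : ℝ) 1, g t * f (t, 1)) -
        ∫ x in upperTriangle, max (g x.1 + x.2 - 1) 0 * phi f x := by
  have hi : IntegrableOn (fun x : ℝ × ℝ => max (g x.1 + x.2 - 1) 0 * phi f x) upperTriangle :=
    integrableOn_continuous_mul_phi hf (by fun_prop)
  rw [integral_upperTriangle_eq_slices hi, ← integral_sub (integrableOn_mul_boundary hf hg)
    (integrableOn_slice hi)]
  rfl

theorem closure_openSquare : closure openSquare = unitSquare := by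
  rw [openSquare, closure_prod_eq, closure_Ioo zero_ne_one]
  rfl

/-- An optimal symmetric mechanism whose boundary utility is improved upon slice by slice by a menu
has the utility of this menu. -/
theorem indirectUtility_eq_menuUtility {f p : ℝ × ℝ → ℝ} (hf : IsSRS f) (hopt : IsOptimal f p)
    (hsymm : IsSymmetric p) {c k : ℝ} (hc : 0 ≤ c)
    (hlt : ∀ᵐ t ∂(volume.restrict (Ioo (0 : ℝ) 1)), boundaryUtility p t ≠ max c (t + k) →
      sliceRevenue f t (boundaryUtility p t) < sliceRevenue f t (max c (t + k))) :
    EqOn (indirectUtility p) (menuUtility c k) unitSquare := by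
  have hft := hf.toIsTypeDensity
  have hp := hopt.1
  have hm := isPriceSchedule_menuPrice c k
  have huc := (lipschitzWith_indirectUtility hp).continuous
  have hgc := continuous_boundaryUtility hp
  have hwc : Continuous fun t : ℝ => max c (t + k) := by fun_prop
  have hTs : upperTriangle ⊆ unitSquare :=
    upperTriangle_subset_openSquare.trans openSquare_subset_unitSquare
  have hms : IsSymmetric (menuPrice c k) := fun x hx => by
    rw [indirectUtility_menuPrice c k hx, indirectUtility_menuPrice c k ⟨hx.2, hx.1⟩,
      menuUtility_swap]
  have hmenu : totalRevenue f (menuPrice c k) =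
      2 * ∫ t in Ioo (0 : ℝ) 1, sliceRevenue f t (max c (t + k)) := by
    rw [totalRevenue_eq hf hm hms, integral_sliceRevenue hft hwc]
    congr 2
    · refine setIntegral_congr_fun measurableSet_Ioo fun t ht => ?_
      simp only [boundaryUtility]
      rw [indirectUtility_menuPrice c k ⟨Ioo_subset_Icc_self ht, zero_le_one, le_rfl⟩,
        menuUtility_boundary hc k ht.2.le]
    · refine setIntegral_congr_fun measurableSet_upperTriangle fun x hx => ?_
      rw [indirectUtility_menuPrice c k (hTs hx), menuUtility_of_le c k hx.2.1.le]
  set v : ℝ × ℝ → ℝ := fun x => max (boundaryUtility p x.1 + x.2 - 1) 0 with hv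
  have hvc : Continuous v := by fun_prop
  have hvle : ∀ x ∈ upperTriangle, v x ≤ indirectUtility p x := fun x hx =>
    lower_bound_indirectUtility hp hx.2.2.le
  have hui := integrableOn_continuous_mul_phi hft huc
  have hvi := integrableOn_continuous_mul_phi hft hvc
  have hgap : ∫ x in upperTriangle, (indirectUtility p x - v x) * phi f x =
      (∫ x in upperTriangle, indirectUtility p x * phi f x) -
        ∫ x in upperTriangle, v x * phi f x := by
    rw [← integral_sub hui hvi]
    simp only [sub_mul]
  have hgapi : IntegrableOn (fun x => (indirectUtility p x - v x) * phi f x) upperTriangle :=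
    integrableOn_continuous_mul_phi hft (huc.sub hvc)
  have hphi : ∀ᵐ x ∂((volume : Measure (ℝ × ℝ)).restrict upperTriangle), 0 < phi f x :=
    ae_restrict_of_ae_restrict_of_subset hTs hf.strictly_regular
  have hgap0 : 0 ≤ᵐ[volume.restrict upperTriangle]
      fun x => (indirectUtility p x - v x) * phi f x := by
    filter_upwards [hphi, ae_restrict_mem measurableSet_upperTriangle] with x hx hxT
    exact mul_nonneg (sub_nonneg.2 (hvle x hxT)) hx.le
  have hsi := (integrableOn_sliceRevenue hft hwc).sub (integrableOn_sliceRevenue hft hgc)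
  have hs0 : 0 ≤ᵐ[volume.restrict (Ioo (0 : ℝ) 1)] fun t =>
      sliceRevenue f t (max c (t + k)) - sliceRevenue f t (boundaryUtility p t) := by
    filter_upwards [hlt] with t ht
    refine sub_nonneg.2 ?_
    by_cases h : boundaryUtility p t = max c (t + k)
    · rw [h]
    · exact (ht h).le
  have hrev := hopt.2 _ hm
  have hI := integral_sliceRevenue hft hgc
  rw [hmenu, totalRevenue_eq hf hp hsymm] at hrev
  have hsint : ∫ t in Ioo (0 : ℝ) 1,
      (sliceRevenue f t (max c (t + k)) - sliceRevenue f t (boundaryUtility p t)) =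
      (∫ t in Ioo (0 : ℝ) 1, sliceRevenue f t (max c (t + k))) -
        ∫ t in Ioo (0 : ℝ) 1, sliceRevenue f t (boundaryUtility p t) :=
    integral_sub (integrableOn_sliceRevenue hft hwc) (integrableOn_sliceRevenue hft hgc)
  have hn1 := integral_nonneg_of_ae hgap0
  have hn2 := integral_nonneg_of_ae hs0
  -- Half the revenue of `p` is its integrated slice revenue minus the gap. Optimality against the
  -- menu thus bounds the sum of the gap and the slice improvement by zero, and both are
  -- nonnegative.
  have hz1 : ∫ x in upperTriangle, (indirectUtility p x - v x) * phi f x = 0 := by linarith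
  have hz2 : ∫ t in Ioo (0 : ℝ) 1,
      (sliceRevenue f t (max c (t + k)) - sliceRevenue f t (boundaryUtility p t)) = 0 := by
    linarith
  have hge : EqOn (boundaryUtility p) (fun t => max c (t + k)) (Ioo 0 1) := by
    refine Measure.eqOn_open_of_ae_eq (μ := volume) ?_ isOpen_Ioo hgc.continuousOn
      hwc.continuousOn
    filter_upwards [(setIntegral_eq_zero_iff_of_nonneg_ae hs0 hsi).1 hz2, hlt] with t ht h
    by_contra hne
    exact (h hne).ne' (sub_eq_zero.1 ht)
  have hue : ∀ᵐ x : ℝ × ℝ, x ∈ upperTriangle → indirectUtility p x = menuUtility c k x := by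
    rw [← ae_restrict_iff' measurableSet_upperTriangle]
    filter_upwards [(setIntegral_eq_zero_iff_of_nonneg_ae hgap0 hgapi).1 hz1, hphi,
      ae_restrict_mem measurableSet_upperTriangle] with x hx hpos hxT
    have h1 := sub_eq_zero.1 ((mul_eq_zero.1 hx).resolve_right hpos.ne')
    have h2 := hge (upperTriangle_subset_openSquare hxT).1
    rw [h1, menuUtility_of_le c k hxT.2.1.le, hv]
    simp only [h2]
  have hopen : EqOn (indirectUtility p) (menuUtility c k) openSquare := by
    refine Measure.eqOn_open_of_ae_eq (μ := volume) ?_ isOpen_openSquare huc.continuousOn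
      (continuous_menuUtility c k).continuousOn
    have hsw : ∀ᵐ x : ℝ × ℝ, x.swap ∈ upperTriangle →
        indirectUtility p x.swap = menuUtility c k x.swap :=
      (Measure.measurePreserving_swap (μ := (volume : Measure ℝ))
        (ν := (volume : Measure ℝ))).quasiMeasurePreserving.ae hue
    filter_upwards [ae_restrict_of_ae hue, ae_restrict_of_ae hsw, ae_restrict_of_ae ae_fst_ne_snd,
      ae_restrict_mem measurableSet_openSquare] with x h1 h2 hne hx
    rcases lt_or_gt_of_ne hne with h | h
    · exact h1 ⟨hx.1.1, h, hx.2.2⟩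
    · rw [← hsymm x (openSquare_subset_unitSquare hx), ← menuUtility_swap]
      exact h2 ⟨hx.2.1, h, hx.1.2⟩
  rw [← closure_openSquare]
  exact hopen.closure huc (continuous_menuUtility c k)

theorem exists_menuUtility {f p : ℝ × ℝ → ℝ} (hf : IsSRS f)
    (hmono : MonotoneOn (zeta f) (Ioo 0 1))
    (hcross : ∃! x : ℝ, x ∈ Ioo (0 : ℝ) 1 ∧ zeta f x = x)
    (hopt : IsOptimal f p) (hsymm : IsSymmetric p) :
    ∃ c k : ℝ, 0 ≤ c ∧ 0 ≤ c - k ∧ c - k < 1 ∧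
      EqOn (indirectUtility p) (menuUtility c k) unitSquare := by
  obtain ⟨a, ⟨ha, hfix⟩, huniq⟩ := hcross
  have hp := hopt.1
  have hgm := monotone_boundaryUtility hp
  obtain ⟨d, hd, hlow, hhigh⟩ := exists_switching_point ha hmono
    (fun x hx h => hx.2.ne (huniq x ⟨⟨hx.1, hx.2.trans ha.2⟩, h⟩))
    (hgm.monotoneOn _) (continuous_boundaryUtility hp).continuousOn
  have hc0 : 0 ≤ boundaryUtility p d := indirectUtility_nonneg hp _
  have hslope := boundaryUtility_sub_le hp hd.2
  have hmon := hgm hd.2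
  -- The flat piece takes the value of `ū` at the switching point `d`; the piece of slope 1 passes
  -- through the graph of `ū` at the crossing `a`. The kink `c - k` lies between `d` and `a`.
  refine ⟨boundaryUtility p d, boundaryUtility p a - a, hc0, by linarith [hd.1],
    by linarith [ha.2], ?_⟩
  refine indirectUtility_eq_menuUtility hf hopt hsymm hc0 ?_
  have hne : ∀ b : ℝ, ∀ᵐ t ∂(volume.restrict (Ioo (0 : ℝ) 1)), t ≠ b := fun b =>
    ae_restrict_of_ae ((countable_singleton b).ae_notMem volume)
  filter_upwards [ae_slice_phi_pos hf, hne a, hne d, ae_restrict_mem measurableSet_Ioo]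
    with t hpos hta htd ht hdiff
  have hg0 : 0 ≤ boundaryUtility p t := indirectUtility_nonneg hp _
  rcases lt_or_gt_of_ne htd with h1 | h1
  · have h2 := boundaryUtility_sub_le hp (h1.le.trans hd.2)
    have h3 := hgm h1.le
    have h4 : max (boundaryUtility p d) (t + (boundaryUtility p a - a)) = boundaryUtility p d :=
      max_eq_left (by linarith)
    rw [h4] at hdiff ⊢
    exact sliceRevenue_lt_of_lt hf.toIsTypeDensity ht hpos hg0 (lt_of_le_of_ne h3 hdiff)
      (hlow t ⟨ht.1, h1⟩)
  rcases lt_or_gt_of_ne hta with h2 | h2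
  · obtain ⟨h3, h4⟩ := hhigh t ⟨h1, h2⟩
    have h5 := boundaryUtility_sub_le hp h2.le
    have h6 : max (boundaryUtility p d) (t + (boundaryUtility p a - a)) ≤ boundaryUtility p t :=
      max_le (hgm h1.le) (by linarith)
    exact sliceRevenue_lt_of_gt hf.toIsTypeDensity ht hpos (hc0.trans (le_max_left _ _))
      (lt_of_le_of_ne h6 hdiff.symm) h3 (h4.trans (le_max_left _ _))
  · have h3 := boundaryUtility_sub_le hp h2.le
    have h4 : boundaryUtility p t ≤ max (boundaryUtility p d) (t + (boundaryUtility p a - a)) :=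
      le_trans (by linarith) (le_max_right _ _)
    exact sliceRevenue_lt_of_lt hf.toIsTypeDensity ht hpos hg0 (lt_of_le_of_ne h4 hdiff)
      (Or.inl (zeta_lt_self_of_gt_crossing hf hmono ha (fun x hx h => huniq x ⟨hx, h⟩) h2 ht.2))

/-! ### Properties of menus -/

/-- A vector supporting `u` from below at a point of differentiability is the gradient. -/
theorem fderiv_eq_of_support {u : ℝ × ℝ → ℝ} {x q : ℝ × ℝ} (hd : DifferentiableAt ℝ u x)
    (h : ∀ᶠ y in 𝓝 x, dot y q - u y ≤ dot x q - u x) :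
    fderiv ℝ u x (1, 0) = q.1 ∧ fderiv ℝ u x (0, 1) = q.2 := by
  set L : ℝ × ℝ →L[ℝ] ℝ :=
    q.1 • ContinuousLinearMap.fst ℝ ℝ ℝ + q.2 • ContinuousLinearMap.snd ℝ ℝ ℝ with hL
  have hLd : ∀ y, L y = dot y q := fun y => by
    simp [hL, dot, mul_comm]
  have hmin : IsLocalMin (fun y => u y - L y) x := by
    filter_upwards [h] with y hy
    rw [hLd, hLd]
    linarith
  have h0 := hmin.hasFDerivAt_eq_zero (hd.hasFDerivAt.sub L.hasFDerivAt)
  rw [sub_eq_zero.1 h0]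
  simp [hL]

/-- Almost every type demands only the bundles of the menu. -/
theorem ae_subdifferential_subset {p : ℝ × ℝ → ℝ} {C : NNReal}
    (hl : LipschitzWith C (indirectUtility p)) {c k : ℝ}
    (h : EqOn (indirectUtility p) (menuUtility c k) unitSquare) :
    ∀ᵐ x ∂((volume : Measure (ℝ × ℝ)).restrict unitSquare), ∀ q ∈ subdifferential p x,
      q = (0, 0) ∨ q = (1, 0) ∨ q = (0, 1) ∨ q = (1, 1) := by
  rw [restrict_unitSquare_eq]
  filter_upwards [ae_restrict_mem measurableSet_openSquare,
    ae_restrict_of_ae (hl.ae_differentiableAt (μ := volume))] with x hx hd q hq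
  have hsq : unitSquare ∈ 𝓝 x :=
    mem_of_superset (isOpen_openSquare.mem_nhds hx) openSquare_subset_unitSquare
  obtain ⟨hq1, hq2⟩ := fderiv_eq_of_support hd (mem_of_superset hsq hq.2)
  -- An affine piece of the menu that is active at `x` supports `u` there, as does `q`; at a point
  -- of differentiability both slopes are the gradient.
  have key : ∀ (r : ℝ × ℝ) (b : ℝ), menuUtility c k x = dot x r + b →
      (∀ y, dot y r + b ≤ menuUtility c k y) → q = r := by
    intro r b hxr hle
    obtain ⟨h1, h2⟩ := fderiv_eq_of_support (q := r) hd <| by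
      filter_upwards [hsq] with y hy
      rw [h hy, h (openSquare_subset_unitSquare hx), hxr]
      linarith [hle y]
    exact Prod.ext (hq1.symm.trans h1) (hq2.symm.trans h2)
  have hcases : menuUtility c k x = 0 ∨ menuUtility c k x = c + x.2 - 1 ∨
      menuUtility c k x = c + x.1 - 1 ∨ menuUtility c k x = x.1 + x.2 - 1 + k := by
    unfold menuUtility
    grind
  rcases hcases with h' | h' | h' | h'
  · refine Or.inl (key _ 0 (by simp [h', dot]) fun y => ?_)
    refine le_trans (le_of_eq ?_) ((le_max_left _ _).trans (le_max_left _ _))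
    simp [dot]
  · refine Or.inr (Or.inr (Or.inl (key _ (c - 1) (by rw [h', dot]; ring) fun y => ?_)))
    refine le_trans (le_of_eq ?_) ((le_max_right _ _).trans (le_max_left _ _))
    rw [dot]
    ring
  · refine Or.inr (Or.inl (key _ (c - 1) (by rw [h', dot]; ring) fun y => ?_))
    refine le_trans (le_of_eq ?_) ((le_max_left _ _).trans (le_max_right _ _))
    rw [dot]
    ring
  · refine Or.inr (Or.inr (Or.inr (key _ (k - 1) (by rw [h', dot]; ring) fun y => ?_)))
    refine le_trans (le_of_eq ?_) ((le_max_right _ _).trans (le_max_right _ _))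
    rw [dot]
    ring

theorem isDeterministic_of_eq_menuUtility (f : ℝ × ℝ → ℝ) {p : ℝ × ℝ → ℝ} {C : NNReal}
    (hl : LipschitzWith C (indirectUtility p)) {c k : ℝ}
    (h : EqOn (indirectUtility p) (menuUtility c k) unitSquare) : IsDeterministic f p := by
  intro q ⟨_, hq0, hact⟩
  by_contra! hcon
  have hpos : ∀ r : ℝ × ℝ, q ≠ r → 0 < √((r.1 - q.1) ^ 2 + (r.2 - q.2) ^ 2) := by
    intro r hr
    refine Real.sqrt_pos.2 (lt_of_le_of_ne (by positivity) fun h0 => hr ?_)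
    refine Prod.ext ?_ ?_ <;> nlinarith [sq_nonneg (r.1 - q.1), sq_nonneg (r.2 - q.2)]
  set δ : ℝ → ℝ → ℝ := fun a b => √((a - q.1) ^ 2 + (b - q.2) ^ 2) with hδ
  -- The radius is the distance from `q` to the nearest of the four menu bundles, so the ball around
  -- `q` contains none of them and almost no type demands a bundle in it.
  have hmin : 0 < min (min (δ 0 0) (δ 1 0)) (min (δ 0 1) (δ 1 1)) :=
    lt_min (lt_min (hpos (0, 0) hq0) (hpos (1, 0) hcon.1))
      (lt_min (hpos (0, 1) hcon.2.1) (hpos (1, 1) hcon.2.2))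
  refine (hact _ hmin).ne' (withDensity_absolutelyContinuous _ _ ?_)
  have hae : ∀ᵐ x ∂((volume : Measure (ℝ × ℝ)).restrict unitSquare),
      x ∉ ⋃ r ∈ nearbyBundles q (min (min (δ 0 0) (δ 1 0)) (min (δ 0 1) (δ 1 1))),
        demandSet p r := by
    filter_upwards [ae_subdifferential_subset hl h] with x hx hmem
    simp only [mem_iUnion, exists_prop] at hmem
    obtain ⟨r, hr, hxr⟩ := hmem
    have hlt := hr.2
    simp only [lt_min_iff] at hlt
    rcases hx r hxr.2 with rfl | rfl | rfl | rfl
    · exact lt_irrefl _ hlt.1.1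
    · exact lt_irrefl _ hlt.1.2
    · exact lt_irrefl _ hlt.2.1
    · exact lt_irrefl _ hlt.2.2
  exact measure_eq_zero_iff_ae_notMem.2 hae

end TwoGoods

end

theorem corollary1 (f : ℝ × ℝ → ℝ) (hf : TwoGoods.IsSRS f)
    (hmono : MonotoneOn (TwoGoods.zeta f) (Set.Ioo 0 1))
    (hcross : ∃! x : ℝ, x ∈ Set.Ioo (0 : ℝ) 1 ∧ TwoGoods.zeta f x = x)
    (p : ℝ × ℝ → ℝ) (hopt : TwoGoods.IsOptimal f p) (hsymm : TwoGoods.IsSymmetric p) :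
    TwoGoods.IsDeterministic f p ∧
    ∃ a : ℝ, 0 ≤ a ∧ a < 1 ∧
      (∀ x ∈ Set.Ico (0 : ℝ) a,
        HasDerivWithinAt (TwoGoods.boundaryUtility p) 0 (Set.Icc 0 1) x) ∧
      (∀ x ∈ Set.Icc a 1,
        HasDerivWithinAt (TwoGoods.boundaryUtility p) 1 (Set.Icc a 1) x) := by
  obtain ⟨c, k, hc, h0, h1, heq⟩ := TwoGoods.exists_menuUtility hf hmono hcross hopt hsymm
  have hb : ∀ t ∈ Set.Icc (0 : ℝ) 1, TwoGoods.boundaryUtility p t = max c (t + k) := fun t ht => by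
    rw [TwoGoods.boundaryUtility, heq ⟨ht, zero_le_one, le_rfl⟩,
      TwoGoods.menuUtility_boundary hc k ht.2]
  -- On `[0,1]` the boundary utility is `max c (t + k)`, whose kink is at `c - k`.
  refine ⟨TwoGoods.isDeterministic_of_eq_menuUtility f
    (TwoGoods.lipschitzWith_indirectUtility hopt.1) heq, c - k, h0, h1, fun x hx => ?_,
    fun x hx => ?_⟩
  · have hx1 : x ∈ Set.Icc (0 : ℝ) 1 := ⟨hx.1, (hx.2.trans h1).le⟩
    refine (hasDerivWithinAt_const x _ c).congr_of_eventuallyEq ?_ ?_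
    · filter_upwards [self_mem_nhdsWithin, mem_nhdsWithin_of_mem_nhds (Iio_mem_nhds hx.2)]
        with t ht htx
      rw [hb t ht, max_eq_left]
      linarith [Set.mem_Iio.1 htx]
    · rw [hb x hx1, max_eq_left]
      linarith [hx.2]
  · refine ((hasDerivWithinAt_id x _).add_const k).congr (fun t ht => ?_) ?_
    · rw [hb t ⟨h0.trans ht.1, ht.2⟩, max_eq_right (by linarith [ht.1])]
      rfl
    · rw [hb x ⟨h0.trans hx.1, hx.2⟩, max_eq_right (by linarith [hx.1])]
      rfl
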